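/- Let $T$ be a tree (a connected graph without cycles, of any cardinality). An embedding of $T$ is an injective map $f:V(T)\to V(T)$ such that $x,y$ are adjacent if and only if $f(x),f(y)$ are adjacent. A ray is a one-way infinite path; two rays are equivalent if their vertex sets agree outside a finite set, and the ends of $T$ are the equivalence classes of rays. $T$ is scattered if no subdivision of the binary tree (the tree of finite $0$-$1$ sequences, each sequence being adjacent to its two one-entry extensions) embeds into $T$. The set $\Omega(T)$ of ends carries the topology with basis the sets $\Omega_{r,s}$ ($s\in V(T)$), where $r$ is a fixed vertex and $\Omega_{r,s}$ is the set of ends whose ray starting at $r$ contains $s$; the topology does not depend on $r$. The order of an end $e$ is the least ordinal $\alpha$ such that $e$ does not belong to the $(\alpha+1)$-st Cantor–Bendixson derivative of $\Omega(T)$. An end is of maximal order if it has an order and its order is at least the order of every other end. An end $e$ is preserved forward (respectively backward) by an embedding $f$ if $f[C]\subseteq C$ (respectively $C\subseteq f[C]$) for some ray $C\in e$; it is almost rigid if every embedding of $T$ preserves it both forward and backward. A ray $C$ is preserved by $f$ if $f[C]\subseteq C$. For a ray $C=\{x_0,x_1,\dots\}$ let $T_{x_i}$ be the tree rooted at $x_i$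 whose vertex set is the connected component of $x_i$ in $T\setminus\{x_{i-1},x_{i+1}\}$ (in $T\setminus\{x_1\}$ if $i=0$). The ray $C$ is regular if, up to equimorphy (mutual embeddability by embeddings sending root to root), there are only finitely many rooted trees $T_{x_i}$. An end is regular if it contains a regular ray. **Theorem 1.3.** 1. If $T$ is scattered and contains exactly one end $e$ of maximal order, then $e$ is preserved forward by every embedding of $T$. 2. If $e$ is a regular end of $T$ which is preserved forward by every embedding of $T$, and if $T$ is scattered or $e$ is not almost rigid, then $e$ contains a ray that is preserved by every embedding of $T$. -/

import Mathlib

universe u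

namespace TreeEmb

/-! ### Subdivisions, the binary tree, scattered trees -/

/-- `S` is a subdivision of `H`: there are distinct branch vertices `φ a` of `S`, one for each
vertex `a` of `H`, and for each edge `ab` of `H` a path `P a b` of `S` from `φ a` to `φ b`
(the same path, reversed, for `b a`), such that these paths are internally disjoint from each
other and from the branch vertices, and `S` has no further vertices and no further edges. -/
def IsSubdivision {W X : Type*} (H : SimpleGraph W) (S : SimpleGraph X) : Prop :=
  ∃ (φ : W ↪ X) (P : ∀ a b : W, H.Adj a b → S.Walk (φ a) (φ b)),
    (∀ a b h, (P a b h).IsPath) ∧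
    (∀ a b (h : H.Adj a b), P b a h.symm = (P a b h).reverse) ∧
    (∀ a b h c, φ c ∈ (P a b h).support → c = a ∨ c = b) ∧
    (∀ a b h a' b' h' x, x ∈ (P a b h).support → x ∈ (P a' b' h').support →
      s(a, b) = s(a', b') ∨ x ∈ Set.range φ) ∧
    (∀ x, x ∈ Set.range φ ∨ ∃ a b h, x ∈ (P a b h).support) ∧
    (∀ x y, S.Adj x y → ∃ a b h, s(x, y) ∈ (P a b h).edges)

/-- The binary (dyadic) tree: its vertices are the finite `0`-`1` sequences, and each sequence `s`
is adjacent to the two sequences obtained by adding one entry on the right of `s`. -/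
def binaryTree : SimpleGraph (List Bool) :=
  SimpleGraph.fromRel fun s t => ∃ i : Bool, t = s ++ [i]

/-- No subdivision of the binary tree is embeddable into `T`. (A subdivision that embeds into `T`
is isomorphic to one on a set of vertices of `T`, so one universe level is enough.) -/
def IsScattered {V : Type u} (T : SimpleGraph V) : Prop :=
  ∀ (X : Type u) (S : SimpleGraph X), IsSubdivision binaryTree S → IsEmpty (S ↪g T)

/-! ### Rays and ends -/

/-- A ray (one-way infinite path) of `T`, given by its vertices `x₀, x₁, x₂, …` listed from its
origin. -/
structure Ray {V : Type u} (T : SimpleGraph V) where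
  /-- the `n`-th vertex -/
  vertex : ℕ → V
  injective : Function.Injective vertex
  adj : ∀ n, T.Adj (vertex n) (vertex (n + 1))

namespace Ray

variable {V : Type u} {T : SimpleGraph V}

/-- The vertex set of a ray. -/
def verts (C : Ray T) : Set V := Set.range C.vertex

/-- Two rays are equivalent if their vertex sets agree outside some finite set of vertices. -/
def Equivalent (C C' : Ray T) : Prop :=
  ∃ F : Set V, F.Finite ∧ C.verts \ F = C'.verts \ F

variable (T) in
theorem equivalent_equivalence : Equivalence (Equivalent (T := T)) where
  refl _ := ⟨∅, Set.finite_empty, rfl⟩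
  symm := fun ⟨F, hF, h⟩ => ⟨F, hF, h.symm⟩
  trans := by
    rintro A B C ⟨F, hF, h⟩ ⟨G, hG, h'⟩
    refine ⟨F ∪ G, hF.union hG, ?_⟩
    rw [← Set.sdiff_sdiff, h, Set.sdiff_sdiff, Set.union_comm, ← Set.sdiff_sdiff, h', Set.sdiff_sdiff]

variable (T) in
/-- The setoid of equivalence of rays. -/
def setoid : Setoid (Ray T) := ⟨Equivalent, equivalent_equivalence T⟩

end Ray

/-- The ends of `T`: the equivalence classes of rays. -/
def TreeEnd {V : Type u} (T : SimpleGraph V) : Type u := Quotient (Ray.setoid T)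

/-- The end to which a ray belongs. -/
def Ray.toEnd {V : Type u} {T : SimpleGraph V} (C : Ray T) : TreeEnd T :=
  Quotient.mk (Ray.setoid T) C

/-! ### Embeddings and ends -/

section Embeddings

variable {V : Type u} {T : SimpleGraph V}

/-- The embedding `f` of `T` preserves the ray `C`, that is `f[C] ⊆ C`. -/
def Ray.PreservedBy (C : Ray T) (f : T ↪g T) : Prop := f '' C.verts ⊆ C.verts

/-- The end `e` is preserved forward by `f`: `f[C] ⊆ C` for some ray `C ∈ e`. -/
def TreeEnd.PreservedForwardBy (e : TreeEnd T) (f : T ↪g T) : Prop :=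
  ∃ C : Ray T, C.toEnd = e ∧ f '' C.verts ⊆ C.verts

/-- The end `e` is preserved backward by `f`: `C ⊆ f[C]` for some ray `C ∈ e`. -/
def TreeEnd.PreservedBackwardBy (e : TreeEnd T) (f : T ↪g T) : Prop :=
  ∃ C : Ray T, C.toEnd = e ∧ C.verts ⊆ f '' C.verts

/-- The end `e` is almost rigid: it is preserved backward and forward by every embedding. -/
def TreeEnd.IsAlmostRigid (e : TreeEnd T) : Prop :=
  ∀ f : T ↪g T, e.PreservedBackwardBy f ∧ e.PreservedForwardBy f

end Embeddings

/-! ### Regular rays and regular ends -/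

/-- The rooted tree `(G, r)` embeds into the rooted tree `(G', r')`. -/
def RootedEmbeds {A B : Type*} (G : SimpleGraph A) (r : A) (G' : SimpleGraph B) (r' : B) : Prop :=
  ∃ g : G ↪g G', g r = r'

section Regular

variable {V : Type u} {T : SimpleGraph V}

/-- For `x ∉ X`, the vertex set of the connected component of `x` in `T ∖ X`. -/
def componentAvoiding (T : SimpleGraph V) (X : Set V) (x : V) : Set V :=
  {y | ∃ p : T.Walk x y, ∀ v ∈ p.support, v ∉ X}

namespace Ray

/-- The neighbours of `x_i` on the ray `x₀, x₁, …`: these are `x_{i-1}` and `x_{i+1}` if `i ≥ 1`,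
and `x_1` only if `i = 0`. -/
def neighbours (C : Ray T) (i : ℕ) : Set V :=
  {v | v = C.vertex (i + 1) ∨ ∃ j, j + 1 = i ∧ v = C.vertex j}

/-- The vertex set of the tree `T_{x_i}` attached to the ray at `x_i`: the connected component of
`x_i` in `T ∖ {x_{i-1}, x_{i+1}}` if `i ≥ 1`, and in `T ∖ {x_1}` if `i = 0`. -/
def piece (C : Ray T) (i : ℕ) : Set V := componentAvoiding T (C.neighbours i) (C.vertex i)

theorem vertex_mem_piece (C : Ray T) (i : ℕ) : C.vertex i ∈ C.piece i := by
  refine ⟨SimpleGraph.Walk.nil, ?_⟩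
  intro v hv
  rw [SimpleGraph.Walk.support_nil, List.mem_singleton] at hv
  subst hv
  rintro (h | ⟨j, hj, h⟩)
  · have := C.injective h
    omega
  · have := C.injective h
    omega

/-- The rooted tree `(T_{x_i}, x_i)` embeds into the rooted tree `(T_{x_j}, x_j)`. -/
def PieceEmbeds (C : Ray T) (i j : ℕ) : Prop :=
  RootedEmbeds (T.induce (C.piece i)) ⟨C.vertex i, C.vertex_mem_piece i⟩
    (T.induce (C.piece j)) ⟨C.vertex j, C.vertex_mem_piece j⟩

/-- A ray is regular if there are only finitely many rooted trees `(T_{x_i}, x_i)` up to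
equimorphy (embeddability in both directions). -/
def IsRegular (C : Ray T) : Prop :=
  ∃ F : Finset ℕ, ∀ i, ∃ j ∈ F, C.PieceEmbeds i j ∧ C.PieceEmbeds j i

end Ray

/-- An end is regular if it contains some regular ray. -/
def TreeEnd.IsRegular (e : TreeEnd T) : Prop := ∃ C : Ray T, C.toEnd = e ∧ C.IsRegular

end Regular

/-! ### The space of ends and the order of an end -/

section Order

variable {V : Type u} {T : SimpleGraph V}

/-- The ends `e` such that the ray starting at `r` and belonging to `e` contains `s`. -/
def endsThrough (T : SimpleGraph V) (r s : V) : Set (TreeEnd T) :=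
  {e | ∃ C : Ray T, C.toEnd = e ∧ C.vertex 0 = r ∧ s ∈ C.verts}

/-- The topology of the space of ends of a tree. For each single vertex `r`, the sets
`endsThrough T r s` form a basis of a topology, which does not depend on `r`; so all of them
together generate that same topology. -/
instance : TopologicalSpace (TreeEnd T) :=
  TopologicalSpace.generateFrom {U | ∃ r s : V, U = endsThrough T r s}

/-- The end `e` has order (rank) `α`: `α` is the least ordinal such that `e` does not belong to
the `(α + 1)`-st Cantor-Bendixson derivative of the space of ends. -/
def TreeEnd.HasOrder (e : TreeEnd T) (α : Ordinal.{u}) : Prop :=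
  IsLeast {β : Ordinal.{u} |
    e ∉ CantorBendixson.iteratedDerivedSet (Set.univ : Set (TreeEnd T)) (β + 1)} α

/-- The order of `e` is at least the order of every other end. -/
def TreeEnd.HasMaximalOrder (e : TreeEnd T) : Prop :=
  ∃ α, e.HasOrder α ∧ ∀ e' : TreeEnd T, ∀ β, e'.HasOrder β → β ≤ α

end Order

end TreeEmb

/-! An embedding acts injectively on the ends and maps every Cantor–Bendixson derivative of `Ω(T)`
into itself, so it fixes the only end `e` of maximal order. If it moved a ray of `e` towards the
origin, the images of this ray under its powers would form a double ray, and the powers would carry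
the ends other than `e` arbitrarily close to the other end of the double ray. That end would thus
lie in the same derivatives as `e`, contradicting uniqueness.

For a regular end fixed by all embeddings, an embedding that does not preserve the tail of the ray
from `x_M` on, where `M` is large, sends the part of the tree at the origin's side of `x_M` into a
branch off the ray. If some embedding shifts the ray by `k > 0`, the origin's parts increase
strictly along the ray, as otherwise a backward shift could be glued together. Infinitely many
failures then squeeze infinitely many branches at a single vertex between origin's parts, and the
origin's part moves into this chain of branches like a guest into Hilbert's hotel, which again
yields a backward shift. If every embedding fixes a tail of the ray, two failures give two self-maps
of an origin's part which move its root to incomparable vertices, and their compositions span a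
subdivision of the binary tree. -/

namespace TreeEmb

open SimpleGraph

variable {V : Type u} {T : SimpleGraph V}

/-! ### Distances and branches -/

theorem length_eq_dist (hT : T.IsAcyclic) {u v : V} {p : T.Walk u v} (hp : p.IsPath) :
    p.length = T.dist u v := by
  obtain ⟨q, hq, hl⟩ := p.reachable.exists_path_of_dist
  rw [← hl, show p = q from
    congrArg Subtype.val ((hT.subsingleton_path u v).elim ⟨p, hp⟩ ⟨q, hq⟩)]

theorem dist_map_embedding {W : Type*} {G : SimpleGraph W} (hG : G.Connected) (hT : T.IsAcyclic)
    (f : G ↪g T) (u v : W) : T.dist (f u) (f v) = G.dist u v := by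
  obtain ⟨q, hq, hl⟩ := hG.exists_path_of_dist u v
  rw [← hl, ← Walk.length_map f.toHom q]
  exact (length_eq_dist hT (hq.map (f := f.toHom) f.injective)).symm

theorem mem_support_iff_dist_add_dist (hT : T.IsTree) {u v x : V} {p : T.Walk u v}
    (hp : p.IsPath) : x ∈ p.support ↔ T.dist u x + T.dist x v = T.dist u v := by
  classical
  constructor
  · intro hx
    rw [← length_eq_dist hT.isAcyclic hp, ← length_eq_dist hT.isAcyclic (hp.takeUntil hx),
      ← length_eq_dist hT.isAcyclic (hp.dropUntil hx), ← Walk.length_append, p.take_spec hx]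
  · intro h
    obtain ⟨p₁, -, h₁⟩ := hT.connected.exists_path_of_dist u x
    obtain ⟨p₂, -, h₂⟩ := hT.connected.exists_path_of_dist x v
    have hpath : (p₁.append p₂).IsPath :=
      Walk.isPath_of_length_eq_dist _ (by rw [Walk.length_append, h₁, h₂, h])
    rw [(hT.existsUnique_path u v).unique hp hpath, Walk.mem_support_append_iff]
    exact Or.inl p₁.end_mem_support

theorem dist_eq_one {u v : V} (h : T.Adj u v) : T.dist u v = 1 := dist_eq_one_iff_adj.2 h

/-- The vertices separated from `x` by the edge `xy`: for adjacent `x` and `y` they form the branch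
of the tree at `x` through `y`. -/
def branch (T : SimpleGraph V) (x y : V) : Set V := {w | T.dist w x = T.dist w y + 1}

theorem mem_branch {x y w : V} : w ∈ branch T x y ↔ T.dist w x = T.dist w y + 1 := Iff.rfl

theorem mem_branch_or (hT : T.IsTree) {x y : V} (h : T.Adj x y) (w : V) :
    w ∈ branch T x y ∨ w ∈ branch T y x := hT.dist_eq_dist_add_one_of_adj w h

theorem notMem_branch_symm {x y w : V} (h : w ∈ branch T x y) : w ∉ branch T y x := by
  rw [mem_branch] at *; omega

theorem left_mem_branch {x y : V} (h : T.Adj x y) : x ∈ branch T y x := by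
  rw [mem_branch, dist_eq_one h, dist_self]

theorem right_mem_branch {x y : V} (h : T.Adj x y) : y ∈ branch T x y := left_mem_branch h.symm

theorem exists_mem_branch (hT : T.IsTree) {x w : V} (h : x ≠ w) :
    ∃ y, T.Adj x y ∧ w ∈ branch T x y := by
  obtain ⟨p, -, hl⟩ := hT.connected.exists_path_of_dist x w
  cases p with
  | nil => exact absurd rfl h
  | @cons _ y _ hxy q =>
    refine ⟨y, hxy, (mem_branch_or hT hxy w).resolve_right fun hw => ?_⟩
    have hq := dist_le q
    rw [Walk.length_cons] at hl
    rw [mem_branch, dist_comm, dist_comm (u := w)] at hw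
    omega

theorem eq_of_mem_branch (hT : T.IsTree) {x y y' w : V} (h : T.Adj x y) (h' : T.Adj x y')
    (hy : w ∈ branch T x y) (hy' : w ∈ branch T x y') : y = y' := by
  have exists_path : ∀ {z}, (hz : T.Adj x z) → w ∈ branch T x z →
      ∃ q : T.Walk z w, (Walk.cons hz q).IsPath := by
    intro z hz hw
    obtain ⟨q, -, hq⟩ := hT.connected.exists_path_of_dist z w
    refine ⟨q, Walk.isPath_of_length_eq_dist _ ?_⟩
    rw [Walk.length_cons, hq, dist_comm, dist_comm (u := x), mem_branch.1 hw]
  obtain ⟨q, hq⟩ := exists_path h hy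
  obtain ⟨q', hq'⟩ := exists_path h' hy'
  injection (hT.existsUnique_path x w).unique hq hq'

theorem branch_subset_branch (hT : T.IsTree) {x y y' : V} (h : T.Adj x y) (h' : T.Adj x y')
    (hne : y ≠ y') : branch T x y ⊆ branch T y' x := fun w hw =>
  (mem_branch_or hT h' w).resolve_left fun hw' => hne (eq_of_mem_branch hT h h' hw hw')

theorem dist_eq_of_mem_branches (hT : T.IsTree) {x y a b : V} (h : T.Adj x y)
    (ha : a ∈ branch T y x) (hb : b ∈ branch T x y) :
    T.dist a b = T.dist a x + 1 + T.dist y b := by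
  obtain ⟨p, hp, hpl⟩ := hT.connected.exists_path_of_dist a x
  obtain ⟨q, hq, hql⟩ := hT.connected.exists_path_of_dist y b
  have p_side : ∀ z ∈ p.support, z ∈ branch T y x := by
    intro z hz
    have := (mem_support_iff_dist_add_dist hT hp).1 hz
    have := hT.connected.dist_triangle (u := a) (v := z) (w := y)
    have := mem_branch_or hT h z
    simp only [mem_branch] at *
    omega
  have q_side : ∀ z ∈ q.support, z ∈ branch T x y := by
    intro z hz
    have := (mem_support_iff_dist_add_dist hT hq).1 hz
    have := hT.connected.dist_triangle (u := x) (v := z) (w := b)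
    have := mem_branch_or hT h z
    simp only [mem_branch, dist_comm (v := x), dist_comm (v := y)] at *
    omega
  have hpath : (p.append (Walk.cons h q)).IsPath := by
    rw [Walk.isPath_def, Walk.support_append, Walk.support_cons, List.tail_cons,
      List.nodup_append]
    exact ⟨hp.support_nodup, hq.support_nodup, fun z hz z' hz' hzz =>
      notMem_branch_symm (p_side z hz) (hzz ▸ q_side z' hz')⟩
  rw [← length_eq_dist hT.isAcyclic hpath, Walk.length_append, Walk.length_cons, hpl, hql]
  omega

theorem dist_eq_add_of_mem_branches (hT : T.IsTree) {x y u v : V} (h : T.Adj x y)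
    (hu : u ∈ branch T x y) (hv : v ∈ branch T y x) :
    T.dist u v = T.dist u x + T.dist x v := by
  have := dist_eq_of_mem_branches hT h.symm hu hv
  rw [mem_branch] at hu
  omega

/-- `u` lies on the path from `r` to `v`, that is, `u ≤ v` in the order of the tree rooted
at `r`. -/
def Below (T : SimpleGraph V) (r u v : V) : Prop := T.dist r u + T.dist u v = T.dist r v

theorem below_iff_mem_branch {x y w : V} (h : T.Adj x y) : Below T x y w ↔ w ∈ branch T x y := by
  rw [Below, mem_branch, dist_eq_one h, dist_comm (u := w), dist_comm (u := w)]
  omega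

namespace Below

theorem refl (r u : V) : Below T r u u := by
  rw [Below, dist_self, add_zero]

theorem root (r v : V) : Below T r r v := by
  rw [Below, dist_self, zero_add]

theorem trans (hT : T.IsTree) {r u v w : V} (h : Below T r u v) (h' : Below T r v w) :
    Below T r u w := by
  have h1 := hT.connected.dist_triangle (u := u) (v := v) (w := w)
  have h2 := hT.connected.dist_triangle (u := r) (v := u) (w := w)
  simp only [Below] at *
  omega

theorem dist_le {r u v : V} (h : Below T r u v) : T.dist r u ≤ T.dist r v := by
  rw [Below] at h
  omega

theorem eq_of_dist_le (hT : T.IsTree) {r u v : V} (h : Below T r u v)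
    (hd : T.dist r v ≤ T.dist r u) : u = v := by
  rw [← hT.connected.dist_eq_zero_iff]
  rw [Below] at h
  omega

theorem antisymm (hT : T.IsTree) {r u v : V} (h : Below T r u v) (h' : Below T r v u) : u = v :=
  h.eq_of_dist_le hT h'.dist_le

theorem total (hT : T.IsTree) {r u u' v : V} (h : Below T r u v) (h' : Below T r u' v) :
    Below T r u u' ∨ Below T r u' u := by
  classical
  obtain ⟨p, hp, -⟩ := hT.connected.exists_path_of_dist r v
  have hu := (mem_support_iff_dist_add_dist hT hp).2 h
  have hu' := (mem_support_iff_dist_add_dist hT hp).2 h'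
  rw [← p.take_spec hu', Walk.mem_support_append_iff] at hu
  rcases hu with hu | hu
  · exact Or.inl ((mem_support_iff_dist_add_dist hT (hp.takeUntil hu')).1 hu)
  · have := (mem_support_iff_dist_add_dist hT (hp.dropUntil hu')).1 hu
    simp only [Below] at *
    omega

theorem of_dist_le (hT : T.IsTree) {r u u' v : V} (h : Below T r u v) (h' : Below T r u' v)
    (hd : T.dist r u ≤ T.dist r u') : Below T r u u' := by
  rcases h.total hT h' with hu | hu
  · exact hu
  · rw [hu.eq_of_dist_le hT hd]
    exact .refl r u

theorem of_mem_branch (hT : T.IsTree) {r x y w : V} (h : T.Adj x y) (hr : r ∈ branch T y x)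
    (hw : w ∈ branch T x y) : Below T r y w := by
  have := dist_eq_of_mem_branches hT h hr hw
  rw [mem_branch] at hr
  rw [Below]
  omega

theorem exists_meet (hT : T.IsTree) (r a b : V) :
    ∃ m, Below T r m a ∧ Below T r m b ∧
      ∀ u, Below T r u a → Below T r u b → Below T r u m := by
  classical
  let P : ℕ → Prop := fun n => ∃ m, Below T r m a ∧ Below T r m b ∧ T.dist r m = n
  obtain ⟨m, hma, hmb, hm⟩ : P (Nat.findGreatest P (T.dist r a)) :=
    Nat.findGreatest_spec (Nat.zero_le _) ⟨r, root r a, root r b, dist_self⟩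
  refine ⟨m, hma, hmb, fun u hu hu' => hu.of_dist_le hT hma ?_⟩
  rw [hm]
  exact Nat.le_findGreatest hu.dist_le ⟨u, hu, hu', rfl⟩

end Below

/-! ### Rays -/

namespace Ray

/-- The part of the origin in the tree cut at the edge `x_n x_{n+1}` of the ray. -/
def back (C : Ray T) (n : ℕ) : Set V := branch T (C.vertex (n + 1)) (C.vertex n)

/-- The part of the end in the tree cut at the edge `x_n x_{n+1}` of the ray. -/
def front (C : Ray T) (n : ℕ) : Set V := branch T (C.vertex n) (C.vertex (n + 1))

theorem mem_back_or_mem_front (hT : T.IsTree) (C : Ray T) (n : ℕ) (w : V) :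
    w ∈ C.back n ∨ w ∈ C.front n :=
  mem_branch_or hT (C.adj n).symm w

theorem dist_of_mem_back (hT : T.IsTree) (C : Ray T) {w : V} {i j : ℕ} (h : w ∈ C.back i)
    (hij : i ≤ j) : T.dist w (C.vertex j) = T.dist w (C.vertex i) + (j - i) := by
  have step : ∀ n, i ≤ n → w ∈ C.back n := by
    intro n hn
    induction n, hn using Nat.le_induction with
    | base => exact h
    | succ n _ ih =>
      refine (C.mem_back_or_mem_front hT (n + 1) w).resolve_right fun hw => ?_
      have := C.injective (eq_of_mem_branch hT (C.adj (n + 1)) (C.adj n).symm hw ih)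
      omega
  induction j, hij using Nat.le_induction with
  | base => simp only [Nat.sub_self, add_zero]
  | succ j hij ih =>
    have := mem_branch.1 (step j hij)
    omega

theorem back_mono (hT : T.IsTree) (C : Ray T) {i j : ℕ} (hij : i ≤ j) : C.back i ⊆ C.back j := by
  intro w hw
  have hj := C.dist_of_mem_back hT hw hij
  have hj' := C.dist_of_mem_back hT hw (hij.trans (Nat.le_add_right j 1))
  rw [back, mem_branch]
  omega

theorem front_anti (hT : T.IsTree) (C : Ray T) {i j : ℕ} (hij : i ≤ j) :
    C.front j ⊆ C.front i := fun w hw =>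
  (C.mem_back_or_mem_front hT i w).resolve_left fun h =>
    notMem_branch_symm hw (C.back_mono hT hij h)

theorem vertex_mem_back (hT : T.IsTree) (C : Ray T) {i j : ℕ} (hij : j ≤ i) :
    C.vertex j ∈ C.back i :=
  C.back_mono hT hij (left_mem_branch (C.adj j))

theorem vertex_mem_front (hT : T.IsTree) (C : Ray T) {i j : ℕ} (hij : i < j) :
    C.vertex j ∈ C.front i := by
  obtain ⟨k, rfl⟩ := Nat.exists_eq_add_of_lt hij
  exact C.front_anti hT (Nat.le_add_right i k) (right_mem_branch (C.adj _))

theorem dist_vertex (hT : T.IsTree) (C : Ray T) {i j : ℕ} (hij : i ≤ j) :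
    T.dist (C.vertex i) (C.vertex j) = j - i := by
  rw [C.dist_of_mem_back hT (C.vertex_mem_back hT le_rfl) hij, dist_self, zero_add]

theorem exists_mem_back (hT : T.IsTree) (C : Ray T) (w : V) : ∃ n, w ∈ C.back n := by
  by_contra! h
  have descent : ∀ n, T.dist w (C.vertex n) + n = T.dist w (C.vertex 0) := by
    intro n
    induction n with
    | zero => rfl
    | succ n ih =>
      have := mem_branch.1 ((C.mem_back_or_mem_front hT n w).resolve_left (h n))
      omega
  have := descent (T.dist w (C.vertex 0) + 1)
  omega

theorem dist_of_mem_back_of_mem_front (hT : T.IsTree) (C : Ray T) {u v : V} {n m : ℕ}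
    (hu : u ∈ C.back n) (hv : v ∈ C.front m) (h : n ≤ m) :
    T.dist u v = T.dist u (C.vertex n) + (m + 1 - n) + T.dist (C.vertex (m + 1)) v := by
  have h1 := dist_eq_of_mem_branches hT (C.adj m) (C.back_mono hT h hu) hv
  have h2 := C.dist_of_mem_back hT hu h
  omega

theorem below_vertex (hT : T.IsTree) (C : Ray T) {i j : ℕ} (h : i ≤ j) :
    Below T (C.vertex 0) (C.vertex i) (C.vertex j) := by
  rw [Below, C.dist_vertex hT (Nat.zero_le _), C.dist_vertex hT h, C.dist_vertex hT (Nat.zero_le _)]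
  omega

theorem exists_eq_of_below (hT : T.IsTree) (C : Ray T) {s : V} {n : ℕ}
    (h : Below T (C.vertex 0) s (C.vertex n)) : ∃ i ≤ n, C.vertex i = s := by
  have hle : T.dist (C.vertex 0) s ≤ n := by
    simpa only [C.dist_vertex hT (Nat.zero_le n), Nat.sub_zero] using h.dist_le
  have hdist := C.dist_vertex hT (Nat.zero_le (T.dist (C.vertex 0) s))
  exact ⟨_, hle, ((C.below_vertex hT hle).of_dist_le hT h hdist.le).eq_of_dist_le hT hdist.ge⟩

/-- The ray obtained by deleting the first `n` vertices. -/
def tail (C : Ray T) (n : ℕ) : Ray T where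
  vertex i := C.vertex (n + i)
  injective _ _ h := Nat.add_left_cancel (C.injective h)
  adj i := C.adj (n + i)

/-- The image of a ray under an embedding. -/
def map (f : T ↪g T) (C : Ray T) : Ray T where
  vertex n := f (C.vertex n)
  injective := f.injective.comp C.injective
  adj n := f.map_adj_iff.2 (C.adj n)

/-- The ray obtained by adding an origin. -/
def cons (hT : T.IsTree) (C : Ray T) (r : V) (h : T.Adj r (C.vertex 0)) (h' : r ≠ C.vertex 1) :
    Ray T where
  vertex n := n.casesOn r C.vertex
  adj n := n.casesOn h C.adj
  injective := by
    have hne : ∀ n, r ≠ C.vertex n := by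
      intro n hn
      have hone := dist_eq_one h
      rw [dist_comm, hn, C.dist_vertex hT (Nat.zero_le n)] at hone
      obtain rfl : n = 1 := by omega
      exact h' hn
    rintro (_ | i) (_ | j) hij
    · rfl
    · exact absurd hij (hne j)
    · exact absurd hij.symm (hne i)
    · exact congrArg _ (C.injective hij)

theorem exists_shift_of_verts_subset (hT : T.IsTree) {D D' : Ray T} (h : D.verts ⊆ D'.verts) :
    ∃ b, ∀ n, D.vertex n = D'.vertex (b + n) := by
  choose σ hσ using fun n => h ⟨n, rfl⟩
  -- `σ` is an isometry of `ℕ`, hence a translation.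
  have isometry : ∀ i j, i ≤ j → σ i + (j - i) = σ j ∨ σ j + (j - i) = σ i := by
    intro i j hij
    have hdist := D.dist_vertex hT hij
    rw [← hσ, ← hσ] at hdist
    rcases le_total (σ i) (σ j) with hle | hle
    · rw [D'.dist_vertex hT hle] at hdist; omega
    · rw [dist_comm, D'.dist_vertex hT hle] at hdist; omega
  refine ⟨σ 0, fun n => ?_⟩
  have h₁ := isometry 0 n (by omega)
  have h₂ := isometry 0 (σ 0 + n + 1) (by omega)
  have h₃ := isometry n (σ 0 + n + 1) (by omega)
  rw [← hσ, show σ n = σ 0 + n by omega]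

theorem verts_sdiff_subset {C D : Ray T} {a b : ℕ}
    (h : ∀ n, C.vertex (a + n) = D.vertex (b + n)) :
    C.verts \ (C.vertex '' Set.Iio a) ⊆ D.verts := by
  rintro _ ⟨⟨n, rfl⟩, hn⟩
  obtain ⟨k, rfl⟩ := Nat.exists_eq_add_of_le (not_lt.1 fun hlt => hn ⟨n, hlt, rfl⟩)
  exact ⟨b + k, (h k).symm⟩

theorem toEnd_eq_of_shift {C D : Ray T} {a b : ℕ}
    (h : ∀ n, C.vertex (a + n) = D.vertex (b + n)) : C.toEnd = D.toEnd := by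
  refine Quotient.sound (s := Ray.setoid T) ⟨C.vertex '' Set.Iio a ∪ D.vertex '' Set.Iio b,
    ((Set.finite_Iio a).image _).union ((Set.finite_Iio b).image _), Set.Subset.antisymm ?_ ?_⟩
  · exact fun v hv => ⟨verts_sdiff_subset h ⟨hv.1, fun hv' => hv.2 (Or.inl hv')⟩, hv.2⟩
  · exact fun v hv =>
      ⟨verts_sdiff_subset (fun n => (h n).symm) ⟨hv.1, fun hv' => hv.2 (Or.inr hv')⟩, hv.2⟩

theorem toEnd_eq_iff (hT : T.IsTree) {C D : Ray T} :
    C.toEnd = D.toEnd ↔ ∃ a b, ∀ n, C.vertex (a + n) = D.vertex (b + n) := by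
  refine ⟨fun h => ?_, fun ⟨_, _, h⟩ => toEnd_eq_of_shift h⟩
  obtain ⟨F, hF, hCD⟩ : C.Equivalent D := Quotient.exact h
  obtain ⟨a, ha⟩ := (hF.preimage C.injective.injOn).bddAbove
  have hsub : (C.tail (a + 1)).verts ⊆ D.verts := by
    rintro _ ⟨n, rfl⟩
    refine (hCD.subset ⟨⟨a + 1 + n, rfl⟩, fun hn => ?_⟩).1
    have := ha (show a + 1 + n ∈ C.vertex ⁻¹' F from hn)
    omega
  exact ⟨a + 1, exists_shift_of_verts_subset hT hsub⟩

theorem toEnd_tail (C : Ray T) (n : ℕ) : (C.tail n).toEnd = C.toEnd :=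
  toEnd_eq_of_shift (a := 0) (b := n) fun i => by rw [Nat.zero_add]; rfl

theorem toEnd_cons (hT : T.IsTree) (C : Ray T) (r : V) (h : T.Adj r (C.vertex 0))
    (h' : r ≠ C.vertex 1) : (C.cons hT r h h').toEnd = C.toEnd :=
  toEnd_eq_of_shift (a := 1) (b := 0) fun i => by rw [Nat.zero_add, Nat.add_comm]; rfl

theorem exists_toEnd_eq_of_origin (hT : T.IsTree) (C : Ray T) (r : V) :
    ∃ D : Ray T, D.toEnd = C.toEnd ∧ D.vertex 0 = r := by
  obtain ⟨p⟩ := hT.connected r (C.vertex 0)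
  generalize hz : C.vertex 0 = z at p
  induction p with
  | nil => exact ⟨C, rfl, hz⟩
  | @cons u v w hadj p ih =>
    obtain ⟨D, hD, rfl⟩ := ih hz
    by_cases h : u = D.vertex 1
    · exact ⟨D.tail 1, (D.toEnd_tail 1).trans hD, h.symm⟩
    · exact ⟨D.cons hT u hadj h, (D.toEnd_cons hT u hadj h).trans hD, rfl⟩

theorem eq_of_vertex_eq (hT : T.IsTree) {C D : Ray T} (h0 : C.vertex 0 = D.vertex 0) {i n : ℕ}
    (h : C.vertex i = D.vertex n) : i = n := by
  have hdist := C.dist_vertex hT (Nat.zero_le i)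
  rw [h0, h, D.dist_vertex hT (Nat.zero_le n)] at hdist
  omega

end Ray

theorem TreeEnd.exists_ray (hT : T.IsTree) (e : TreeEnd T) (r : V) :
    ∃ C : Ray T, C.toEnd = e ∧ C.vertex 0 = r := by
  induction e using Quotient.ind with
  | _ C => exact C.exists_toEnd_eq_of_origin hT r

theorem toEnd_mem_endsThrough_iff (hT : T.IsTree) {r s : V} {C : Ray T} :
    C.toEnd ∈ endsThrough T r s ↔ ∀ᶠ n in Filter.atTop, Below T r s (C.vertex n) := by
  rw [Filter.eventually_atTop]
  constructor
  · rintro ⟨D, hD, rfl, i, rfl⟩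
    obtain ⟨a, b, hab⟩ := (Ray.toEnd_eq_iff hT).1 hD
    refine ⟨b + i, fun n hn => ?_⟩
    obtain ⟨k, rfl⟩ := Nat.exists_eq_add_of_le (show b ≤ n by omega)
    rw [← hab]
    exact D.below_vertex hT (by omega)
  · rintro ⟨N, hN⟩
    obtain ⟨D, hD, rfl⟩ := C.exists_toEnd_eq_of_origin hT r
    obtain ⟨a, b, hab⟩ := (Ray.toEnd_eq_iff hT).1 hD
    have hs := hN (b + N) (by omega)
    rw [← hab] at hs
    obtain ⟨i, -, hi⟩ := D.exists_eq_of_below hT hs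
    exact ⟨D, hD, rfl, i, hi⟩

/-! ### Subdivisions of the binary tree -/

theorem Below.symm {u x v : V} (h : Below T u x v) : Below T v x u := by
  rw [Below, dist_comm (u := v) (v := x), dist_comm (u := x) (v := u), dist_comm (u := v) (v := u),
    add_comm]
  exact h

theorem below_iff_of_below (hT : T.IsTree) {r a b : V} (hab : Below T r a b) {x : V} :
    Below T a x b ↔ Below T r a x ∧ Below T r x b := by
  have h1 := hT.connected.dist_triangle (u := r) (v := a) (w := x)
  have h2 := hT.connected.dist_triangle (u := r) (v := x) (w := b)
  simp only [Below] at *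
  omega

theorem induce_connected_of_walks {s : Set V} {x : V} (hx : x ∈ s)
    (h : ∀ y ∈ s, ∃ p : T.Walk x y, ∀ z ∈ p.support, z ∈ s) : (T.induce s).Connected := by
  refine (connected_iff_exists_forall_reachable _).2 ⟨⟨x, hx⟩, fun ⟨y, hy⟩ => ?_⟩
  obtain ⟨p, hp⟩ := h y hy
  exact (p.induce s hp).reachable

theorem dist_induce (hT : T.IsTree) {s : Set V} (hs : (T.induce s).Connected) (x y : s) :
    (T.induce s).dist x y = T.dist x y :=
  (dist_map_embedding hs hT.isAcyclic (Embedding.induce s) x y).symm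

theorem mem_edges_of_adj (hT : T.IsTree) {u v x y : V} {p : T.Walk u v} (hp : p.IsPath)
    (hxy : T.Adj x y) (hx : Below T u x v) (hy : Below T u y v) : s(x, y) ∈ p.edges := by
  wlog hd : T.dist u y = T.dist u x + 1 generalizing x y
  · rw [Sym2.eq_swap]
    exact this hxy.symm hy hx ((hT.dist_eq_dist_add_one_of_adj u hxy).resolve_right hd)
  obtain ⟨p₁, -, h₁⟩ := hT.connected.exists_path_of_dist u x
  obtain ⟨p₂, -, h₂⟩ := hT.connected.exists_path_of_dist y v
  have hpath : (p₁.append (Walk.cons hxy p₂)).IsPath := by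
    refine Walk.isPath_of_length_eq_dist _ ?_
    rw [Below] at hy
    rw [Walk.length_append, Walk.length_cons]
    omega
  rw [(hT.existsUnique_path u v).unique hp hpath, Walk.edges_append, Walk.edges_cons]
  exact List.mem_append_right _ List.mem_cons_self

theorem isSubdivision_of_isTree {W X : Type*} {H : SimpleGraph W} {S : SimpleGraph X}
    (hS : S.IsTree) (φ : W ↪ X)
    (below_vertex : ∀ a b c, H.Adj a b → Below S (φ a) (φ c) (φ b) → c = a ∨ c = b)
    (disjoint : ∀ a b a' b' x, H.Adj a b → H.Adj a' b' → Below S (φ a) x (φ b) →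
      Below S (φ a') x (φ b') → s(a, b) = s(a', b') ∨ x ∈ Set.range φ)
    (cover : ∀ x, x ∈ Set.range φ ∨ ∃ a b, H.Adj a b ∧ Below S (φ a) x (φ b))
    (cover_adj : ∀ x y, S.Adj x y →
      ∃ a b, H.Adj a b ∧ Below S (φ a) x (φ b) ∧ Below S (φ a) y (φ b)) :
    IsSubdivision H S := by
  choose P hP using fun a b => (hS.existsUnique_path (φ a) (φ b)).exists
  have mem_support : ∀ {a b x}, x ∈ (P a b).support ↔ Below S (φ a) x (φ b) :=
    mem_support_iff_dist_add_dist hS (hP _ _)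
  refine ⟨φ, fun a b _ => P a b, fun a b _ => hP a b, fun a b _ =>
    (hS.existsUnique_path _ _).unique (hP b a) (hP a b).reverse, fun a b h c hc =>
    below_vertex a b c h (mem_support.1 hc), fun a b h a' b' h' x hx hx' =>
    disjoint a b a' b' x h h' (mem_support.1 hx) (mem_support.1 hx'), fun x => ?_,
    fun x y hxy => ?_⟩
  · exact (cover x).imp_right fun ⟨a, b, h, hx⟩ => ⟨a, b, h, mem_support.2 hx⟩
  · obtain ⟨a, b, h, hx, hy⟩ := cover_adj x y hxy
    exact ⟨a, b, h, mem_edges_of_adj hS (hP a b) hxy hx hy⟩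

theorem binaryTree_adj {a b : List Bool} :
    binaryTree.Adj a b ↔ (∃ i, b = a ++ [i]) ∨ ∃ i, a = b ++ [i] := by
  rw [binaryTree, fromRel_adj]
  refine ⟨And.right, fun h => ⟨?_, h⟩⟩
  rintro rfl
  rcases h with ⟨i, h⟩ | ⟨i, h⟩ <;> exact absurd (congrArg List.length h) (by simp)

theorem prefix_or_prefix_or_fork (a b : List Bool) :
    a <+: b ∨ b <+: a ∨ ∃ p i u v, a = p ++ i :: u ∧ b = p ++ (!i) :: v := by
  induction a generalizing b with
  | nil => exact Or.inl List.nil_prefix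
  | cons i a ih =>
    rcases b with _ | ⟨j, b⟩
    · exact Or.inr (Or.inl List.nil_prefix)
    by_cases hij : j = i
    · subst hij
      rcases ih b with h | h | ⟨p, k, u, v, rfl, rfl⟩
      · exact Or.inl (List.cons_prefix_cons.2 ⟨rfl, h⟩)
      · exact Or.inr (Or.inl (List.cons_prefix_cons.2 ⟨rfl, h⟩))
      · exact Or.inr (Or.inr ⟨j :: p, k, u, v, rfl, rfl⟩)
    · exact Or.inr (Or.inr ⟨[], i, a, b, rfl, by rw [Bool.eq_not.2 hij]; rfl⟩)

/-- A family of vertices indexed by the `0`-`1` sequences which is ordered, in the tree rooted at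
`r`, like the binary tree: `meet` says that the meet of two vertices of the family is again the
expected one. -/
structure IsBinarySystem (T : SimpleGraph V) (r : V) (φ : List Bool → V) : Prop where
  mono : ∀ w i, Below T r (φ w) (φ (w ++ [i]))
  ne : ∀ w i, φ w ≠ φ (w ++ [i])
  meet : ∀ p i u v x, Below T r x (φ (p ++ i :: u)) → Below T r x (φ (p ++ (!i) :: v)) →
    Below T r x (φ p)

theorem below_of_prefix (hT : T.IsTree) {r : V} {φ : List Bool → V}
    (mono : ∀ w i, Below T r (φ w) (φ (w ++ [i]))) {w w' : List Bool} (h : w <+: w') :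
    Below T r (φ w) (φ w') := by
  obtain ⟨u, rfl⟩ := h
  induction u using List.reverseRecOn with
  | nil => rw [List.append_nil]; exact .refl _ _
  | append_singleton u i ih => rw [← List.append_assoc]; exact ih.trans hT (mono _ _)

namespace IsBinarySystem

variable {r : V} {φ : List Bool → V}

theorem below_iff_prefix (hφ : IsBinarySystem T r φ) (hT : T.IsTree) {c d : List Bool} :
    Below T r (φ c) (φ d) ↔ c <+: d := by
  refine ⟨fun h => ?_, below_of_prefix hT hφ.mono⟩
  have not_below : ∀ p i u, ¬ Below T r (φ (p ++ i :: u)) (φ p) := by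
    intro p i u hb
    have hpi : Below T r (φ (p ++ [i])) (φ (p ++ i :: u)) :=
      below_of_prefix hT hφ.mono ⟨u, by rw [List.append_assoc, List.singleton_append]⟩
    exact hφ.ne p i ((hφ.mono p i).antisymm hT (hpi.trans hT hb))
  rcases prefix_or_prefix_or_fork c d with hcd | ⟨_ | ⟨i, u⟩, rfl⟩ | ⟨p, i, u, v, rfl, rfl⟩
  · exact hcd
  · rw [List.append_nil]
  · exact absurd h (not_below _ _ _)
  · exact absurd (hφ.meet p i u v _ (.refl _ _) h) (not_below _ _ _)

theorem injective (hφ : IsBinarySystem T r φ) (hT : T.IsTree) : Function.Injective φ := by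
  intro c d h
  have hcd : c <+: d := (hφ.below_iff_prefix hT).1 (h ▸ .refl _ _)
  have hdc : d <+: c := (hφ.below_iff_prefix hT).1 (h ▸ .refl _ _)
  exact hcd.eq_of_length_le hdc.length_le

theorem exists_segment_of_adj (hφ : IsBinarySystem T r φ) (hT : T.IsTree) {a b : List Bool}
    (h : binaryTree.Adj a b) : ∃ w i, s(a, b) = s(w, w ++ [i]) ∧
      ∀ x, Below T (φ a) x (φ b) → Below T r (φ w) x ∧ Below T r x (φ (w ++ [i])) := by
  rcases binaryTree_adj.1 h with ⟨i, rfl⟩ | ⟨i, rfl⟩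
  · exact ⟨a, i, rfl, fun x hx => (below_iff_of_below hT (hφ.mono a i)).1 hx⟩
  · exact ⟨b, i, Sym2.eq_swap, fun x hx => (below_iff_of_below hT (hφ.mono b i)).1 hx.symm⟩

theorem eq_or_eq_of_below (hφ : IsBinarySystem T r φ) (hT : T.IsTree) {a b c : List Bool}
    (h : binaryTree.Adj a b) (hc : Below T (φ a) (φ c) (φ b)) : c = a ∨ c = b := by
  obtain ⟨w, i, hw, hseg⟩ := hφ.exists_segment_of_adj hT h
  obtain ⟨hwc, hcw⟩ := hseg _ hc
  rw [hφ.below_iff_prefix hT] at hwc hcw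
  rw [← Sym2.mem_iff, hw, Sym2.mem_iff]
  rcases List.prefix_concat_iff.1 hcw with h' | h'
  · exact Or.inr h'
  · exact Or.inl (h'.eq_of_length_le hwc.length_le)

theorem eq_or_mem_range (hφ : IsBinarySystem T r φ) (hT : T.IsTree) {a b a' b' : List Bool} {x : V}
    (h : binaryTree.Adj a b) (h' : binaryTree.Adj a' b') (hx : Below T (φ a) x (φ b))
    (hx' : Below T (φ a') x (φ b')) : s(a, b) = s(a', b') ∨ x ∈ Set.range φ := by
  obtain ⟨w, i, hw, hseg⟩ := hφ.exists_segment_of_adj hT h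
  obtain ⟨w', i', hw', hseg'⟩ := hφ.exists_segment_of_adj hT h'
  obtain ⟨hwx, hxw⟩ := hseg x hx
  obtain ⟨hwx', hxw'⟩ := hseg' x hx'
  have of_prefix : ∀ {w w' : List Bool} {i i' : Bool}, Below T r x (φ (w ++ [i])) →
      Below T r (φ w') x → w ++ [i] <+: w' ++ [i'] →
      s(w, w ++ [i]) = s(w', w' ++ [i']) ∨ x ∈ Set.range φ := by
    intro w w' i i' hxw hwx' hp
    rcases List.prefix_concat_iff.1 hp with hp | hp
    · obtain ⟨rfl, hi⟩ := List.append_inj' hp rfl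
      exact Or.inl (by rw [hi])
    · exact Or.inr ⟨_, ((below_of_prefix hT hφ.mono hp).trans hT hwx').antisymm hT hxw⟩
  rw [hw, hw']
  rcases prefix_or_prefix_or_fork (w ++ [i]) (w' ++ [i']) with hp | hp | ⟨p, j, u, v, hp, hp'⟩
  · exact of_prefix hxw hwx' hp
  · exact (of_prefix hxw' hwx hp).imp_left Eq.symm
  · have hxp : Below T r x (φ p) := hφ.meet p j u v x (hp ▸ hxw) (hp' ▸ hxw')
    have hpw : p <+: w := by
      rcases List.prefix_concat_iff.1 (show p <+: w ++ [i] from ⟨j :: u, hp.symm⟩) with h | h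
      · exact absurd (congrArg List.length (h ▸ hp)) (by simp)
      · exact h
    exact Or.inr ⟨w, hwx.antisymm hT (hxp.trans hT (below_of_prefix hT hφ.mono hpw))⟩

theorem exists_segment_of_below (hφ : IsBinarySystem T r φ) (hT : T.IsTree) {x : V}
    (h0 : Below T r (φ []) x) {w : List Bool} (hw : Below T r x (φ w)) (hne : x ≠ φ []) :
    ∃ w i, Below T r (φ w) x ∧ x ≠ φ w ∧ Below T r x (φ (w ++ [i])) := by
  induction w using List.reverseRecOn with
  | nil => exact absurd (hw.antisymm hT h0) hne
  | append_singleton w i ih =>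
    by_cases hx : Below T r x (φ w)
    · exact ih hx
    · exact ⟨w, i, (hw.total hT (hφ.mono w i)).resolve_left hx, fun h => hx (h ▸ .refl _ _), hw⟩

/-- The vertex set of the subtree spanned by a binary system. -/
def hull (T : SimpleGraph V) (r : V) (φ : List Bool → V) : Set V :=
  {x | Below T r (φ []) x ∧ ∃ w, Below T r x (φ w)}

theorem mem_hull (hφ : IsBinarySystem T r φ) (hT : T.IsTree) (w : List Bool) : φ w ∈ hull T r φ :=
  ⟨below_of_prefix hT hφ.mono List.nil_prefix, w, .refl _ _⟩

theorem isTree_induce_hull (hφ : IsBinarySystem T r φ) (hT : T.IsTree) :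
    (T.induce (hull T r φ)).IsTree := by
  refine ⟨induce_connected_of_walks (hφ.mem_hull hT []) ?_, hT.isAcyclic.induce _⟩
  rintro y ⟨h0, w, hw⟩
  obtain ⟨p, hp, -⟩ := hT.connected.exists_path_of_dist (φ []) y
  refine ⟨p, fun z hz => ?_⟩
  obtain ⟨h0z, hzy⟩ :=
    (below_iff_of_below hT h0).1 ((mem_support_iff_dist_add_dist hT hp).1 hz)
  exact ⟨h0z, w, hzy.trans hT hw⟩

theorem exists_adj_of_adj (hφ : IsBinarySystem T r φ) (hT : T.IsTree) {x y : V}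
    (hx : x ∈ hull T r φ) (hy : y ∈ hull T r φ) (hxy : T.Adj x y) :
    ∃ a b, binaryTree.Adj a b ∧ Below T (φ a) x (φ b) ∧ Below T (φ a) y (φ b) := by
  wlog hb : Below T r x y generalizing x y
  · obtain ⟨a, b, h, hya, hxa⟩ := this hy hx hxy.symm <| by
      have := dist_eq_one hxy
      have := dist_eq_one hxy.symm
      have := hT.dist_eq_dist_add_one_of_adj r hxy
      rw [Below] at *
      omega
    exact ⟨a, b, h, hxa, hya⟩
  obtain ⟨h0, w, hw⟩ := hy
  have hne : y ≠ φ [] := by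
    rintro rfl
    exact hxy.ne (hb.antisymm hT hx.1)
  obtain ⟨w, i, hwy, hn, hyw⟩ := hφ.exists_segment_of_below hT h0 hw hne
  have hwx : Below T r (φ w) x := by
    have := dist_eq_one hxy
    have := hT.connected.pos_dist_of_ne hn.symm
    refine hwy.of_dist_le hT hb ?_
    simp only [Below] at *
    omega
  have hseg := fun z => (below_iff_of_below hT (x := z) (hφ.mono w i)).2
  exact ⟨w, w ++ [i], binaryTree_adj.2 (Or.inl ⟨i, rfl⟩), hseg x ⟨hwx, hb.trans hT hyw⟩,
    hseg y ⟨hwy, hyw⟩⟩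

theorem not_isScattered (hφ : IsBinarySystem T r φ) (hT : T.IsTree) : ¬ IsScattered T := by
  intro hs
  have hX := hφ.isTree_induce_hull hT
  have below_iff : ∀ a x b : hull T r φ, Below (T.induce (hull T r φ)) a x b ↔ Below T a x b :=
    fun a x b => by simp only [Below, dist_induce hT hX.connected]
  refine (hs _ (T.induce (hull T r φ)) (isSubdivision_of_isTree hX
    ⟨fun w => ⟨φ w, hφ.mem_hull hT w⟩, fun c d h => hφ.injective hT (congrArg Subtype.val h)⟩
    ?_ ?_ ?_ ?_)).false (Embedding.induce _)
  · exact fun a b c h hc => hφ.eq_or_eq_of_below hT h ((below_iff _ _ _).1 hc)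
  · exact fun a b a' b' x h h' hx hx' =>
      (hφ.eq_or_mem_range hT h h' ((below_iff _ _ _).1 hx) ((below_iff _ _ _).1 hx')).imp_right
        fun ⟨w, hw⟩ => ⟨w, Subtype.ext hw⟩
  · rintro ⟨x, hx⟩
    by_cases h : x = φ []
    · exact Or.inl ⟨[], Subtype.ext h.symm⟩
    · obtain ⟨w, i, hwx, -, hxw⟩ := hφ.exists_segment_of_below hT hx.1 hx.2.choose_spec h
      exact Or.inr ⟨w, w ++ [i], binaryTree_adj.2 (Or.inl ⟨i, rfl⟩),
        (below_iff _ _ _).2 ((below_iff_of_below hT (hφ.mono w i)).2 ⟨hwx, hxw⟩)⟩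
  · rintro ⟨x, hx⟩ ⟨y, hy⟩ hxy
    obtain ⟨a, b, h, hxab, hyab⟩ := hφ.exists_adj_of_adj hT hx hy hxy
    exact ⟨a, b, h, (below_iff _ _ _).2 hxab, (below_iff _ _ _).2 hyab⟩

end IsBinarySystem

theorem exists_isBinarySystem (hT : T.IsTree) {r : V} {σ : List Bool → V}
    (mono : ∀ w i, Below T r (σ w) (σ (w ++ [i])))
    (incomparable : ∀ w i, ¬ Below T r (σ (w ++ [i])) (σ (w ++ [!i]))) :
    ∃ φ, IsBinarySystem T r φ := by
  choose m hm_true hm_false le_m using fun w =>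
    Below.exists_meet hT r (σ (w ++ [true])) (σ (w ++ [false]))
  have m_le : ∀ w i, Below T r (m w) (σ (w ++ [i])) :=
    fun w i => i.casesOn (hm_false w) (hm_true w)
  have σ_le : ∀ {w w'}, w <+: w' → Below T r (σ w) (m w') := fun h =>
    (below_of_prefix hT mono h).trans hT (le_m _ _ (mono _ _) (mono _ _))
  have le_child : ∀ p i u v x, Below T r x (m (p ++ i :: u)) → Below T r x (m (p ++ (!i) :: v)) →
      Below T r x (σ (p ++ [i])) := by
    intro p i u v x hxu hxv
    have hi : Below T r (σ (p ++ [i])) (m (p ++ i :: u)) :=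
      σ_le ⟨u, by rw [List.append_assoc, List.singleton_append]⟩
    have hni : Below T r (σ (p ++ [!i])) (m (p ++ (!i) :: v)) :=
      σ_le ⟨v, by rw [List.append_assoc, List.singleton_append]⟩
    refine (hxu.total hT hi).resolve_right fun h => ?_
    rcases (h.trans hT hxv).total hT hni with h' | h'
    · exact incomparable p i h'
    · exact incomparable p (!i) (by rwa [Bool.not_not])
  refine ⟨m, fun w i => (m_le w i).trans hT (σ_le List.prefix_rfl), fun w i h => ?_,
    fun p i u v x hxu hxv => ?_⟩
  · have hle : Below T r (σ (w ++ [i])) (m (w ++ [i])) := σ_le List.prefix_rfl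
    exact incomparable w i ((h ▸ hle).trans hT (m_le w _))
  · have hxi := le_child p i u v x hxu hxv
    have hxni := le_child p (!i) v u x hxv (by rwa [Bool.not_not])
    cases i
    · exact le_m p x hxni hxi
    · exact le_m p x hxi hxni

theorem not_isScattered_of_branching (hT : T.IsTree) (r : V) {G : Set V} (hG : G.Nonempty)
    (h : ∀ s ∈ G, ∃ a ∈ G, ∃ b ∈ G, Below T r s a ∧ Below T r s b ∧ ¬ Below T r a b ∧
      ¬ Below T r b a) : ¬ IsScattered T := by
  have exists_children : ∀ s : G, ∃ c : Bool → G, (∀ i, Below T r s (c i)) ∧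
      ∀ i, ¬ Below T r (c i : V) (c !i) := by
    rintro ⟨s, hs⟩
    obtain ⟨a, ha, b, hb, hsa, hsb, hab, hba⟩ := h s hs
    exact ⟨fun i => cond i ⟨a, ha⟩ ⟨b, hb⟩, by rintro (_ | _) <;> assumption,
      by rintro (_ | _) <;> assumption⟩
  choose child below_child incomparable using exists_children
  obtain ⟨s₀, hs₀⟩ := hG
  let σ : List Bool → G := fun w => w.reverse.rec ⟨s₀, hs₀⟩ fun i _ s => child s i
  have hσ : ∀ w i, σ (w ++ [i]) = child (σ w) i := by
    intro w i
    simp only [σ, List.reverse_append, List.reverse_cons, List.reverse_nil, List.nil_append,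
      List.singleton_append]
  obtain ⟨φ, hφ⟩ := exists_isBinarySystem hT (r := r) (σ := fun w => (σ w).1)
    (fun w i => hσ w i ▸ below_child _ i)
    (fun w i => hσ w i ▸ hσ w (!i) ▸ incomparable _ i)
  exact hφ.not_isScattered hT

/-! ### The space of ends -/

open CantorBendixson

theorem toEnd_mem_endsThrough_iff_of_adj (hT : T.IsTree) {u v : V} (h : T.Adj u v) {C : Ray T} :
    C.toEnd ∈ endsThrough T u v ↔ ∀ᶠ n in Filter.atTop, C.vertex n ∈ branch T u v := by
  simp only [toEnd_mem_endsThrough_iff hT, below_iff_mem_branch h]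

theorem mem_endsThrough_or (hT : T.IsTree) {u v : V} (h : T.Adj u v) (e : TreeEnd T) :
    e ∈ endsThrough T u v ∨ e ∈ endsThrough T v u := by
  obtain ⟨D, rfl, rfl⟩ := e.exists_ray hT u
  by_cases hv : D.vertex 1 = v
  · exact Or.inl ⟨D, rfl, rfl, 1, hv⟩
  · refine Or.inr ((toEnd_mem_endsThrough_iff_of_adj hT h.symm).2 (.of_forall ?_))
    rintro (_ | n)
    · exact left_mem_branch h
    · exact branch_subset_branch hT (D.adj 0) h hv (D.vertex_mem_front hT (Nat.succ_pos n))

theorem notMem_endsThrough_symm (hT : T.IsTree) {u v : V} (h : T.Adj u v) {e : TreeEnd T}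
    (he : e ∈ endsThrough T u v) : e ∉ endsThrough T v u := by
  intro he'
  obtain ⟨D, rfl, -⟩ := e.exists_ray hT u
  obtain ⟨n, hn, hn'⟩ := (((toEnd_mem_endsThrough_iff_of_adj hT h).1 he).and
    ((toEnd_mem_endsThrough_iff_of_adj hT h.symm).1 he')).exists
  exact notMem_branch_symm hn hn'

/-- The ends in the front part of the tree cut at the edge `x_n x_{n+1}` of the ray. -/
abbrev Ray.frontEnds (C : Ray T) (n : ℕ) : Set (TreeEnd T) :=
  endsThrough T (C.vertex n) (C.vertex (n + 1))

namespace Ray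

theorem toEnd_mem_frontEnds (hT : T.IsTree) (C : Ray T) (n : ℕ) : C.toEnd ∈ C.frontEnds n :=
  (toEnd_mem_endsThrough_iff_of_adj hT (C.adj n)).2 <|
    (Filter.eventually_gt_atTop n).mono fun _ => C.vertex_mem_front hT

theorem frontEnds_anti (hT : T.IsTree) (C : Ray T) {i j : ℕ} (h : i ≤ j) :
    C.frontEnds j ⊆ C.frontEnds i := by
  intro e he
  obtain ⟨D, rfl, -⟩ := e.exists_ray hT (C.vertex 0)
  rw [frontEnds, toEnd_mem_endsThrough_iff_of_adj hT (C.adj _)] at he ⊢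
  exact he.mono fun n => @C.front_anti _ _ hT _ _ h _

theorem frontEnds_subset_endsThrough (hT : T.IsTree) {C : Ray T} {r s : V}
    (h : C.toEnd ∈ endsThrough T r s) : ∃ n, C.frontEnds n ⊆ endsThrough T r s := by
  obtain ⟨N, hN⟩ := Filter.eventually_atTop.1 ((toEnd_mem_endsThrough_iff hT).1 h)
  obtain ⟨M, hM⟩ := C.exists_mem_back hT r
  refine ⟨max N M, fun e he => ?_⟩
  obtain ⟨D, rfl, -⟩ := e.exists_ray hT r
  rw [toEnd_mem_endsThrough_iff hT]
  filter_upwards [(toEnd_mem_endsThrough_iff_of_adj hT (C.adj _)).1 he] with n hn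
  exact (hN (max N M + 1) (by omega)).trans hT
    (.of_mem_branch hT (C.adj _) (C.back_mono hT (le_max_right N M) hM) hn)

theorem vertex_eq_of_mem_frontEnds (hT : T.IsTree) {C D : Ray T} (h0 : D.vertex 0 = C.vertex 0)
    {n : ℕ} (h : D.toEnd ∈ C.frontEnds n) {i : ℕ} (hi : i ≤ n + 1) : D.vertex i = C.vertex i := by
  obtain ⟨N, hN⟩ := ((toEnd_mem_endsThrough_iff_of_adj hT (C.adj n)).1 h).exists
  have hbelow := (C.below_vertex hT hi).trans hT
    (.of_mem_branch hT (C.adj n) (C.vertex_mem_back hT (Nat.zero_le n)) hN)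
  rw [← h0] at hbelow
  obtain ⟨j, -, hj⟩ := D.exists_eq_of_below hT hbelow
  rw [← hj, eq_of_vertex_eq hT h0 hj]

theorem eq_toEnd_of_forall_mem_frontEnds (hT : T.IsTree) {C : Ray T} {e : TreeEnd T}
    (h : ∀ n, e ∈ C.frontEnds n) : e = C.toEnd := by
  obtain ⟨D, rfl, h0⟩ := e.exists_ray hT (C.vertex 0)
  exact toEnd_eq_of_shift (a := 0) (b := 0) fun n => by
    rw [Nat.zero_add, vertex_eq_of_mem_frontEnds hT h0 (h n) (Nat.le_succ n)]

theorem exists_incomparable (hT : T.IsTree) {C D : Ray T} (h0 : D.vertex 0 = C.vertex 0)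
    (hne : D.toEnd ≠ C.toEnd) (n : ℕ) : ∃ m, n ≤ m ∧
      ¬ Below T (C.vertex 0) (C.vertex m) (D.vertex m) ∧
      ¬ Below T (C.vertex 0) (D.vertex m) (C.vertex m) := by
  obtain ⟨k, hk⟩ : ∃ k, D.vertex k ≠ C.vertex k := by
    by_contra! h
    exact hne (toEnd_eq_of_shift (a := 0) (b := 0) fun n => by rw [h])
  have hm : D.vertex (max k n) ≠ C.vertex (max k n) := by
    intro h
    have hbelow := D.below_vertex hT (le_max_left k n)
    rw [h, h0] at hbelow
    obtain ⟨j, -, hj⟩ := C.exists_eq_of_below hT hbelow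
    exact hk (by rw [← hj, eq_of_vertex_eq hT h0.symm hj])
  have hC := C.dist_vertex hT (Nat.zero_le (max k n))
  have hD := D.dist_vertex hT (Nat.zero_le (max k n))
  rw [h0] at hD
  exact ⟨max k n, le_max_right k n, fun h => hm (h.eq_of_dist_le hT (hD.trans hC.symm).le).symm,
    fun h => hm (h.eq_of_dist_le hT (hC.trans hD.symm).le)⟩

theorem nhds_toEnd_hasBasis (hT : T.IsTree) (C : Ray T) :
    (nhds C.toEnd).HasBasis (fun _ : ℕ => True) C.frontEnds := by
  have hnhds : nhds C.toEnd = ⨅ n : ℕ, Filter.principal (C.frontEnds n) := by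
    apply le_antisymm
    · refine le_iInf fun n => Filter.le_principal_iff.2 (IsOpen.mem_nhds ?_ ?_)
      · exact TopologicalSpace.isOpen_generateFrom_of_mem ⟨_, _, rfl⟩
      · exact C.toEnd_mem_frontEnds hT n
    · rw [TopologicalSpace.nhds_generateFrom]
      refine le_iInf₂ fun U hU => ?_
      obtain ⟨hmem, r, s, rfl⟩ := hU
      obtain ⟨n, hn⟩ := frontEnds_subset_endsThrough hT hmem
      exact (iInf_le _ n).trans (Filter.principal_mono.2 hn)
  rw [hnhds]
  exact Filter.hasBasis_iInf_principal
    (directed_of_isDirected_le fun i j hij => C.frontEnds_anti hT hij)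

theorem accPt_toEnd_iff (hT : T.IsTree) {C : Ray T} {A : Set (TreeEnd T)} :
    AccPt C.toEnd (Filter.principal A) ↔ ∀ n, ∃ e ∈ A, e ≠ C.toEnd ∧ e ∈ C.frontEnds n := by
  rw [accPt_iff_nhds]
  constructor
  · intro h n
    obtain ⟨e, ⟨hn, hA⟩, hne⟩ := h _ ((C.nhds_toEnd_hasBasis hT).mem_of_mem (i := n) trivial)
    exact ⟨e, hA, hne, hn⟩
  · intro h U hU
    obtain ⟨n, -, hnU⟩ := (C.nhds_toEnd_hasBasis hT).mem_iff.1 hU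
    obtain ⟨e, hA, hne, hn⟩ := h n
    exact ⟨e, ⟨hnU hn, hA⟩, hne⟩

end Ray

theorem not_isScattered_of_perfect (hT : T.IsTree) {A : Set (TreeEnd T)} (hA : Perfect A)
    (hne : A.Nonempty) : ¬ IsScattered T := by
  obtain ⟨r⟩ := hT.connected.nonempty
  refine not_isScattered_of_branching hT r (G := {s | ∃ e ∈ A, e ∈ endsThrough T r s}) ?_ ?_
  · obtain ⟨e, he⟩ := hne
    obtain ⟨C, rfl, h0⟩ := e.exists_ray hT r
    exact ⟨r, _, he, C, rfl, h0, 0, h0⟩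
  · rintro s ⟨_, he, C, rfl, rfl, n, rfl⟩
    obtain ⟨e', he', hne, hfront⟩ := (Ray.accPt_toEnd_iff hT).1 (hA.acc _ he) n
    obtain ⟨D, rfl, h0⟩ := e'.exists_ray hT (C.vertex 0)
    obtain ⟨m, hnm, hCD, hDC⟩ := Ray.exists_incomparable hT h0 hne n
    refine ⟨C.vertex m, ⟨_, he, C, rfl, rfl, _, rfl⟩, D.vertex m, ⟨_, he', D, rfl, h0, _, rfl⟩,
      C.below_vertex hT hnm, ?_, hCD, hDC⟩
    rw [← Ray.vertex_eq_of_mem_frontEnds hT h0 hfront (Nat.le_succ n), ← h0]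
    exact D.below_vertex hT hnm

namespace TreeEnd

theorem exists_hasOrder_of_isScattered (hT : T.IsTree) (hs : IsScattered T) (e : TreeEnd T) :
    ∃ α, e.HasOrder α := by
  obtain ⟨β, hβ⟩ :
      ∃ β : Ordinal.{u}, e ∉ iteratedDerivedSet (Set.univ : Set (TreeEnd T)) β := by
    by_contra! h
    exact not_isScattered_of_perfect hT (perfect_perfectKernel isClosed_univ)
      ⟨e, Set.mem_iInter.2 h⟩ hs
  let S : Set Ordinal.{u} := {β | e ∉ iteratedDerivedSet (Set.univ : Set (TreeEnd T)) (β + 1)}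
  have hS : S.Nonempty := ⟨β, fun h => hβ (iteratedDerivedSet_antitone _ (Order.le_succ β) h)⟩
  exact ⟨sInf S, csInf_mem hS, fun b hb => csInf_le' hb⟩

theorem HasOrder.mem_iteratedDerivedSet {e : TreeEnd T} {α : Ordinal.{u}} (h : e.HasOrder α) :
    e ∈ iteratedDerivedSet (Set.univ : Set (TreeEnd T)) α := by
  have mem_succ : ∀ β < α, e ∈ iteratedDerivedSet (Set.univ : Set (TreeEnd T)) (β + 1) :=
    fun β hβ => by_contra fun hn => (h.2 hn).not_gt hβ
  induction α using Ordinal.limitRecOn with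
  | zero => simp
  | add_one a _ => exact mem_succ a (lt_add_one a)
  | limit a ha _ =>
    rw [iteratedDerivedSet_limit ha]
    exact Set.mem_iInter.2 fun b =>
      iteratedDerivedSet_antitone _ (Order.le_succ b.1) (mem_succ b.1 b.2)

theorem HasOrder.hasMaximalOrder {e : TreeEnd T} {α β : Ordinal.{u}} (h : e.HasOrder β)
    (hα : ∀ e' : TreeEnd T, ∀ γ, e'.HasOrder γ → γ ≤ α)
    (hmem : e ∈ iteratedDerivedSet (Set.univ : Set (TreeEnd T)) α) : e.HasMaximalOrder := by
  have hle : α ≤ β := by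
    by_contra! hlt
    exact h.1 (iteratedDerivedSet_antitone _ (Order.succ_le_of_lt hlt) hmem)
  obtain rfl := le_antisymm (hα e β h) hle
  exact ⟨_, h, hα⟩

end TreeEnd

/-! ### The action of embeddings on the ends -/

theorem map_mem_branch (hT : T.IsTree) (f : T ↪g T) {u v w : V} (h : w ∈ branch T u v) :
    f w ∈ branch T (f u) (f v) := by
  rw [mem_branch] at h ⊢
  rw [dist_map_embedding hT.connected hT.isAcyclic, dist_map_embedding hT.connected hT.isAcyclic, h]

/-- The map on ends induced by an embedding. -/
def endMap (f : T ↪g T) : TreeEnd T → TreeEnd T :=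
  Quotient.map' (Ray.map f) (by
    rintro C D ⟨F, hF, h⟩
    have verts_map : ∀ C : Ray T, (C.map f).verts = f '' C.verts :=
      fun C => Set.range_comp f C.vertex
    refine ⟨f '' F, hF.image f, ?_⟩
    rw [verts_map, verts_map, ← Set.image_sdiff f.injective, ← Set.image_sdiff f.injective, h])

theorem endMap_toEnd (f : T ↪g T) (C : Ray T) : endMap f C.toEnd = (C.map f).toEnd := rfl

theorem endMap_injective (hT : T.IsTree) (f : T ↪g T) : Function.Injective (endMap f) := by
  intro e e' h
  obtain ⟨r⟩ := hT.connected.nonempty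
  obtain ⟨C, rfl, -⟩ := e.exists_ray hT r
  obtain ⟨D, rfl, -⟩ := e'.exists_ray hT r
  obtain ⟨a, b, hab⟩ := (Ray.toEnd_eq_iff hT).1 h
  exact Ray.toEnd_eq_of_shift fun n => f.injective (hab n)

theorem endMap_mem_endsThrough (hT : T.IsTree) (f : T ↪g T) {u v : V} (h : T.Adj u v)
    {e : TreeEnd T} (he : e ∈ endsThrough T u v) : endMap f e ∈ endsThrough T (f u) (f v) := by
  obtain ⟨C, rfl, -⟩ := e.exists_ray hT u
  exact (toEnd_mem_endsThrough_iff_of_adj hT (f.map_adj_iff.2 h)).2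
    (((toEnd_mem_endsThrough_iff_of_adj hT h).1 he).mono fun _ => map_mem_branch hT f)

theorem toEnd_mem_iteratedDerivedSet_succ_iff (hT : T.IsTree) {C : Ray T} {β : Ordinal.{u}} :
    C.toEnd ∈ iteratedDerivedSet (Set.univ : Set (TreeEnd T)) (β + 1) ↔
      (∀ n, ∃ e ∈ iteratedDerivedSet (Set.univ : Set (TreeEnd T)) β,
        e ≠ C.toEnd ∧ e ∈ C.frontEnds n) ∧
      C.toEnd ∈ iteratedDerivedSet (Set.univ : Set (TreeEnd T)) β := by
  rw [iteratedDerivedSet_succ, relDerivedSet_apply, Set.mem_inter_iff, mem_derivedSet,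
    C.accPt_toEnd_iff hT]

theorem endMap_mem_iteratedDerivedSet (hT : T.IsTree) (f : T ↪g T) {β : Ordinal.{u}}
    {e : TreeEnd T} (he : e ∈ iteratedDerivedSet (Set.univ : Set (TreeEnd T)) β) :
    endMap f e ∈ iteratedDerivedSet (Set.univ : Set (TreeEnd T)) β := by
  induction β using Ordinal.limitRecOn generalizing e with
  | zero => simp
  | add_one β ih =>
    obtain ⟨r⟩ := hT.connected.nonempty
    obtain ⟨C, rfl, -⟩ := e.exists_ray hT r
    rw [toEnd_mem_iteratedDerivedSet_succ_iff hT] at he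
    rw [endMap_toEnd, toEnd_mem_iteratedDerivedSet_succ_iff hT]
    refine ⟨fun n => ?_, ih he.2⟩
    obtain ⟨e, hmem, hne, hfront⟩ := he.1 n
    exact ⟨endMap f e, ih hmem, (endMap_injective hT f).ne hne,
      endMap_mem_endsThrough hT f (C.adj n) hfront⟩
  | limit β hβ ih =>
    rw [iteratedDerivedSet_limit hβ, Set.mem_iInter] at he ⊢
    exact fun b => ih b.1 b.2 (he b)

section BackwardShift

variable {f : T ↪g T} {C : Ray T} {d : ℕ}

theorem pow_apply_vertex_eq_iff (h : ∀ n, f (C.vertex (n + (d + 1))) = C.vertex n) (i j n l : ℕ) :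
    (f ^ i) (C.vertex n) = (f ^ j) (C.vertex l) ↔ n + j * (d + 1) = l + i * (d + 1) := by
  have pow_shift : ∀ s n, (f ^ s) (C.vertex (n + s * (d + 1))) = C.vertex n := by
    intro s
    induction s with
    | zero => intro n; rw [zero_mul, add_zero]; rfl
    | succ s ih =>
      intro n
      rw [pow_succ, RelEmbedding.mul_apply, add_mul, one_mul, ← add_assoc, h, ih]
  have pow_add_apply : ∀ i s n l, (f ^ i) (C.vertex n) = (f ^ (i + s)) (C.vertex l) ↔
      n + s * (d + 1) = l := by
    intro i s n l
    rw [pow_add, RelEmbedding.mul_apply, (f ^ i).injective.eq_iff, ← pow_shift s n,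
      (f ^ s).injective.eq_iff, C.injective.eq_iff]
  rcases le_total i j with hij | hij <;> obtain ⟨s, rfl⟩ := Nat.exists_eq_add_of_le hij
  · rw [pow_add_apply, add_mul]
    omega
  · rw [eq_comm, pow_add_apply, add_mul]
    omega

/-- If `f` shifts a ray towards its origin, then the images of the ray under the powers of `f` form
a double ray; this is the half of the double ray opposite to `C`. -/
def oppositeRay (f : T ↪g T) (C : Ray T) (d : ℕ)
    (h : ∀ n, f (C.vertex (n + (d + 1))) = C.vertex n) : Ray T where
  vertex k := (f ^ k) (C.vertex (k * d))
  injective k l hkl := by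
    have := (pow_apply_vertex_eq_iff h k l _ _).1 hkl
    linarith
  adj k := by
    have hk : (f ^ k) (C.vertex (k * d)) = (f ^ (k + 1)) (C.vertex ((k + 1) * d + 1)) :=
      (pow_apply_vertex_eq_iff h _ _ _ _).2 (by ring)
    rw [hk]
    exact (f ^ (k + 1)).map_adj_iff.2 (C.adj _).symm

theorem pow_apply_vertex_eq_oppositeRay (h : ∀ n, f (C.vertex (n + (d + 1))) = C.vertex n)
    {j n k : ℕ} (hk : n + k = j * (d + 1)) :
    (f ^ j) (C.vertex n) = (oppositeRay f C d h).vertex k :=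
  (pow_apply_vertex_eq_iff h _ _ _ _).2 (by rw [← hk]; ring)

theorem endMap_pow_oppositeRay_toEnd (h : ∀ n, f (C.vertex (n + (d + 1))) = C.vertex n) (j : ℕ) :
    endMap (f ^ j) (oppositeRay f C d h).toEnd = (oppositeRay f C d h).toEnd := by
  refine Ray.toEnd_eq_of_shift (a := 0) (b := j * (d + 1)) fun k => ?_
  change (f ^ j * f ^ (0 + k)) (C.vertex ((0 + k) * d)) = _
  rw [← pow_add]
  exact (pow_apply_vertex_eq_iff h _ _ _ _).2 (by ring)

theorem oppositeRay_toEnd_ne (hT : T.IsTree) (h : ∀ n, f (C.vertex (n + (d + 1))) = C.vertex n) :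
    (oppositeRay f C d h).toEnd ≠ C.toEnd := by
  intro he
  obtain ⟨a, b, hab⟩ := (Ray.toEnd_eq_iff hT).1 he
  have := (pow_apply_vertex_eq_iff h _ 0 _ _).1 (hab 1)
  linarith

theorem oppositeRay_toEnd_mem_endsThrough (hT : T.IsTree)
    (h : ∀ n, f (C.vertex (n + (d + 1))) = C.vertex n) :
    (oppositeRay f C d h).toEnd ∈ endsThrough T (C.vertex 1) (C.vertex 0) := by
  refine (toEnd_mem_endsThrough_iff_of_adj hT (C.adj 0).symm).2 (.of_forall fun k => ?_)
  have hmem := map_mem_branch hT (f ^ k)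
    (C.vertex_mem_back hT (show k * d ≤ k * (d + 1) by gcongr; exact Nat.le_succ d))
  rwa [(pow_apply_vertex_eq_iff h k 0 (k * (d + 1)) 0).2 (by ring),
    (pow_apply_vertex_eq_iff h k 0 (k * (d + 1) + 1) 1).2 (by ring)] at hmem

theorem exists_endMap_pow_mem_frontEnds (hT : T.IsTree)
    (h : ∀ n, f (C.vertex (n + (d + 1))) = C.vertex n) {e : TreeEnd T} (he : e ≠ C.toEnd) (n : ℕ) :
    ∃ j, endMap (f ^ j) e ∈ (oppositeRay f C d h).frontEnds n := by
  obtain ⟨M, hM⟩ : ∃ M, e ∉ C.frontEnds M := by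
    by_contra! hall
    exact he (Ray.eq_toEnd_of_forall_mem_frontEnds hT hall)
  refine ⟨M + 1 + n, ?_⟩
  have hmem := endMap_mem_endsThrough hT (f ^ (M + 1 + n)) (C.adj M).symm
    ((mem_endsThrough_or hT (C.adj M) e).resolve_left hM)
  rw [pow_apply_vertex_eq_oppositeRay h (k := n + (M + 1 + n) * d) (by ring),
    pow_apply_vertex_eq_oppositeRay h (k := n + (M + 1 + n) * d + 1) (by ring)] at hmem
  exact Ray.frontEnds_anti hT _ (Nat.le_add_right _ _) hmem

theorem oppositeRay_toEnd_mem_iteratedDerivedSet (hT : T.IsTree)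
    (h : ∀ n, f (C.vertex (n + (d + 1))) = C.vertex n) {β : Ordinal.{u}}
    (hC : C.toEnd ∈ iteratedDerivedSet (Set.univ : Set (TreeEnd T)) β) :
    (oppositeRay f C d h).toEnd ∈ iteratedDerivedSet (Set.univ : Set (TreeEnd T)) β := by
  induction β using Ordinal.limitRecOn with
  | zero => simp
  | limit β hβ ih =>
    rw [iteratedDerivedSet_limit hβ, Set.mem_iInter] at hC ⊢
    exact fun b => ih b.1 b.2 (hC b)
  | add_one β ih =>
    rw [toEnd_mem_iteratedDerivedSet_succ_iff hT] at hC ⊢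
    refine ⟨fun n => ?_, ih hC.2⟩
    obtain ⟨e, hmem, hne, hfront⟩ := hC.1 0
    have hne' : e ≠ (oppositeRay f C d h).toEnd := by
      rintro rfl
      exact notMem_endsThrough_symm hT (C.adj 0) hfront (oppositeRay_toEnd_mem_endsThrough hT h)
    obtain ⟨j, hj⟩ := exists_endMap_pow_mem_frontEnds hT h hne n
    refine ⟨_, endMap_mem_iteratedDerivedSet hT (f ^ j) hmem, ?_, hj⟩
    rw [← endMap_pow_oppositeRay_toEnd h j]
    exact (endMap_injective hT _).ne hne'

end BackwardShift

theorem preservedForwardBy_of_shift {f : T ↪g T} {C : Ray T} {a b : ℕ} (hab : a ≤ b)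
    (h : ∀ n, f (C.vertex (a + n)) = C.vertex (b + n)) : C.toEnd.PreservedForwardBy f := by
  refine ⟨C.tail a, C.toEnd_tail a, ?_⟩
  rintro _ ⟨_, ⟨n, rfl⟩, rfl⟩
  refine ⟨b - a + n, ?_⟩
  change C.vertex (a + (b - a + n)) = f (C.vertex (a + n))
  rw [h, ← add_assoc, Nat.add_sub_cancel' hab]

theorem preservedForwardBy_of_unique_maximal (hT : T.IsTree) (hs : IsScattered T) {e : TreeEnd T}
    (he : e.HasMaximalOrder) (hu : ∀ e' : TreeEnd T, e'.HasMaximalOrder → e' = e) (f : T ↪g T) :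
    e.PreservedForwardBy f := by
  obtain ⟨α, hα, hmax⟩ := he
  have eq_of_mem : ∀ e' ∈ iteratedDerivedSet (Set.univ : Set (TreeEnd T)) α, e' = e := by
    intro e' he'
    obtain ⟨β, hβ⟩ := e'.exists_hasOrder_of_isScattered hT hs
    exact hu e' (hβ.hasMaximalOrder hmax he')
  have hmem := hα.mem_iteratedDerivedSet
  obtain ⟨r⟩ := hT.connected.nonempty
  obtain ⟨C, rfl, -⟩ := e.exists_ray hT r
  obtain ⟨a, b, hab⟩ :=
    (Ray.toEnd_eq_iff hT).1 (eq_of_mem _ (endMap_mem_iteratedDerivedSet hT f hmem))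
  rcases le_or_gt a b with hle | hlt
  · exact preservedForwardBy_of_shift hle hab
  · exfalso
    obtain ⟨d, rfl⟩ := Nat.exists_eq_add_of_lt hlt
    have hshift : ∀ n, f ((C.tail b).vertex (n + (d + 1))) = (C.tail b).vertex n := by
      intro n
      change f (C.vertex (b + (n + (d + 1)))) = C.vertex (b + n)
      rw [show b + (n + (d + 1)) = b + d + 1 + n by ring]
      exact hab n
    rw [← C.toEnd_tail b] at hmem eq_of_mem
    exact oppositeRay_toEnd_ne hT hshift
      (eq_of_mem _ (oppositeRay_toEnd_mem_iteratedDerivedSet hT hshift hmem))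

/-! ### Rooted sets of vertices -/

/-- `φ` preserves the distances between the vertices of `S`. -/
def IsoOn (T : SimpleGraph V) (S : Set V) (φ : V → V) : Prop :=
  ∀ u ∈ S, ∀ v ∈ S, T.dist (φ u) (φ v) = T.dist u v

namespace IsoOn

theorem mono {S S' : Set V} {φ : V → V} (h : IsoOn T S' φ) (hS : S ⊆ S') : IsoOn T S φ :=
  fun u hu v hv => h u (hS hu) v (hS hv)

theorem comp {S S' : Set V} {φ ψ : V → V} (hψ : IsoOn T S' ψ) (hφ : IsoOn T S φ)
    (hmaps : Set.MapsTo φ S S') : IsoOn T S (ψ ∘ φ) := fun u hu v hv =>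
  (hψ _ (hmaps hu) _ (hmaps hv)).trans (hφ u hu v hv)

theorem injOn (hT : T.IsTree) {S : Set V} {φ : V → V} (h : IsoOn T S φ) : Set.InjOn φ S := by
  intro u hu v hv huv
  rw [← hT.connected.dist_eq_zero_iff, ← h u hu v hv, huv, dist_self]

theorem adj {S : Set V} {φ : V → V} (h : IsoOn T S φ) {u v : V} (hu : u ∈ S) (hv : v ∈ S)
    (huv : T.Adj u v) : T.Adj (φ u) (φ v) := by
  rw [← dist_eq_one_iff_adj, h u hu v hv, dist_eq_one huv]

theorem mapsTo_branch {S : Set V} {φ : V → V} (h : IsoOn T S φ) {u v : V} (hu : u ∈ S) (hv : v ∈ S)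
    (hS : branch T u v ⊆ S) : Set.MapsTo φ (branch T u v) (branch T (φ u) (φ v)) := by
  intro w hw
  rw [mem_branch, h w (hS hw) u hu, h w (hS hw) v hv]
  exact hw

theorem of_embedding (hT : T.IsTree) (f : T ↪g T) (S : Set V) : IsoOn T S f :=
  fun u _ v _ => dist_map_embedding hT.connected hT.isAcyclic f u v

/-- A distance-preserving self-map of the whole tree is an embedding. -/
def toEmbedding (hT : T.IsTree) {φ : V → V} (h : IsoOn T Set.univ φ) : T ↪g T where
  toFun := φ
  inj' := Set.injOn_univ.1 (h.injOn hT)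
  map_rel_iff' {u v} := by
    change T.Adj (φ u) (φ v) ↔ T.Adj u v
    rw [← dist_eq_one_iff_adj, h u trivial v trivial, dist_eq_one_iff_adj]

end IsoOn

/-- A set of vertices of `T` with a distinguished vertex, its root. The rooted sets are preordered
by the existence of a distance-preserving map which sends root to root; for rooted subtrees this is
embeddability of rooted trees. -/
structure RootedSet (T : SimpleGraph V) where
  /-- the set of vertices -/
  carrier : Set V
  /-- the root -/
  root : V

instance : Preorder (RootedSet T) where
  le A B := ∃ φ : V → V, IsoOn T A.carrier φ ∧ Set.MapsTo φ A.carrier B.carrier ∧ φ A.root = B.root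
  le_refl _ := ⟨id, fun _ _ _ _ => rfl, Set.mapsTo_id _, rfl⟩
  le_trans := by
    rintro A B C ⟨φ, hφ, hAB, hroot⟩ ⟨ψ, hψ, hBC, hroot'⟩
    exact ⟨ψ ∘ φ, hψ.comp hφ hAB, hBC.comp hAB, by rw [Function.comp_apply, hroot, hroot']⟩

theorem RootedSet.le_of_rootedEmbeds (hT : T.IsTree) {S S' : Set V} {r r' : V} {hr : r ∈ S}
    {hr' : r' ∈ S'} (hS : (T.induce S).Connected)
    (h : RootedEmbeds (T.induce S) ⟨r, hr⟩ (T.induce S') ⟨r', hr'⟩) :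
    (⟨S, r⟩ : RootedSet T) ≤ ⟨S', r'⟩ := by
  classical
  obtain ⟨g, hg⟩ := h
  refine ⟨fun w => if hw : w ∈ S then g ⟨w, hw⟩ else w, fun u hu v hv => ?_, fun w hw => ?_, ?_⟩
  · simp only [dif_pos hu, dif_pos hv]
    exact (dist_map_embedding hS hT.isAcyclic ((Embedding.induce S').comp g) _ _).trans
      (dist_induce hT hS _ _)
  · simp only [dif_pos hw]
    exact (g ⟨w, hw⟩).2
  · simp only [dif_pos hr]
    exact congrArg Subtype.val hg

/-- The branch at `x` through `y`, rooted at `y`. -/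
def rootedBranch (T : SimpleGraph V) (x y : V) : RootedSet T := ⟨branch T x y, y⟩

theorem rootedBranch_le_map (hT : T.IsTree) (f : T ↪g T) (x y : V) :
    rootedBranch T x y ≤ rootedBranch T (f x) (f y) :=
  ⟨f, .of_embedding hT f _, fun _ => map_mem_branch hT f, rfl⟩

/-! ### Components of the tree without some neighbours of a vertex -/

theorem induce_componentAvoiding_connected {X : Set V} {x : V} (hx : x ∉ X) :
    (T.induce (componentAvoiding T X x)).Connected := by
  classical
  refine induce_connected_of_walks (x := x) ⟨.nil, fun v hv => ?_⟩ fun y ⟨p, hp⟩ => ⟨p, fun z hz =>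
    ⟨p.takeUntil z hz, fun v hv => hp v (p.support_takeUntil_subset_support hz hv)⟩⟩
  rwa [Walk.mem_support_nil_iff.1 hv]

theorem mem_componentAvoiding_iff (hT : T.IsTree) {X : Set V} {x w : V}
    (hX : X ⊆ T.neighborSet x) : w ∈ componentAvoiding T X x ↔ ∀ y ∈ X, w ∈ branch T y x := by
  classical
  constructor
  · rintro ⟨p, hp⟩ y hy
    refine (mem_branch_or hT (hX hy) w).resolve_left fun hw => hp y ?_ hy
    exact p.support_bypass_subset_support ((mem_support_iff_dist_add_dist hT p.bypass_isPath).2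
      ((below_iff_mem_branch (hX hy)).2 hw))
  · intro h
    obtain ⟨p, hp⟩ := (hT.existsUnique_path x w).exists
    exact ⟨p, fun z hz hzX => notMem_branch_symm (h z hzX) ((below_iff_mem_branch (hX hzX)).1
      ((mem_support_iff_dist_add_dist hT hp).1 hz))⟩

theorem mem_componentAvoiding_iff_exists_mem_branch (hT : T.IsTree) {X : Set V} {x w : V}
    (hX : X ⊆ T.neighborSet x) : w ∈ componentAvoiding T X x ↔
      w = x ∨ ∃ y ∈ T.neighborSet x \ X, w ∈ branch T x y := by
  rw [mem_componentAvoiding_iff hT hX]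
  constructor
  · intro h
    refine or_iff_not_imp_left.2 fun hw => ?_
    obtain ⟨y, hy, hwy⟩ := exists_mem_branch hT (Ne.symm hw)
    exact ⟨y, ⟨hy, fun hyX => notMem_branch_symm hwy (h y hyX)⟩, hwy⟩
  · rintro (rfl | ⟨y, ⟨hy, hyX⟩, hw⟩) z hz
    · exact left_mem_branch (hX hz)
    · exact branch_subset_branch hT hy (hX hz) (fun h => hyX (h ▸ hz)) hw

theorem branch_eq_componentAvoiding (hT : T.IsTree) {x y : V} (h : T.Adj x y) :
    branch T y x = componentAvoiding T {y} x := by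
  ext w
  simp only [mem_componentAvoiding_iff hT (Set.singleton_subset_iff.2 h), Set.mem_singleton_iff,
    forall_eq]

/-- The connected component of `x` in `T ∖ X`, rooted at `x`. -/
def rootedComponent (T : SimpleGraph V) (X : Set V) (x : V) : RootedSet T :=
  ⟨componentAvoiding T X x, x⟩

theorem rootedComponent_le_map (hT : T.IsTree) (f : T ↪g T) {X X' : Set V} {x : V}
    (hX : X ⊆ T.neighborSet x) (hX' : X' ⊆ f '' X) :
    rootedComponent T X x ≤ rootedComponent T X' (f x) := by
  have hnbr : X' ⊆ T.neighborSet (f x) := by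
    intro y hy
    obtain ⟨z, hz, rfl⟩ := hX' hy
    exact f.map_adj_iff.2 (hX hz)
  refine ⟨f, .of_embedding hT f _, fun w hw => ?_, rfl⟩
  refine (mem_componentAvoiding_iff hT hnbr).2 fun y hy => ?_
  obtain ⟨z, hz, rfl⟩ := hX' hy
  exact map_mem_branch hT f ((mem_componentAvoiding_iff hT hX).1 hw z hz)

theorem exists_branchMap_of_rootedComponent_le (hT : T.IsTree) {X X' : Set V} {x x' : V}
    (hX : X ⊆ T.neighborSet x) (hX' : X' ⊆ T.neighborSet x')
    (h : rootedComponent T X x ≤ rootedComponent T X' x') :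
    ∃ ι : V → V, Set.MapsTo ι (T.neighborSet x \ X) (T.neighborSet x' \ X') ∧
      Set.InjOn ι (T.neighborSet x \ X) ∧
      ∀ y ∈ T.neighborSet x \ X, rootedBranch T x y ≤ rootedBranch T x' (ι y) := by
  obtain ⟨φ, hφ, hmaps, hroot⟩ := h
  change φ x = x' at hroot
  have hx : x ∈ componentAvoiding T X x :=
    (mem_componentAvoiding_iff_exists_mem_branch hT hX).2 (Or.inl rfl)
  have branch_subset : ∀ y ∈ T.neighborSet x \ X, branch T x y ⊆ componentAvoiding T X x :=
    fun y hy w hw => (mem_componentAvoiding_iff_exists_mem_branch hT hX).2 (Or.inr ⟨y, hy, hw⟩)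
  have hmem : T.neighborSet x \ X ⊆ componentAvoiding T X x :=
    fun y hy => branch_subset y hy (right_mem_branch hy.1)
  refine ⟨φ, fun y hy => ⟨?_, fun hyX => ?_⟩, (hφ.injOn hT).mono hmem, fun y hy => ?_⟩
  · exact hroot ▸ hφ.adj hx (hmem hy) hy.1
  · exact notMem_branch_symm ((mem_componentAvoiding_iff hT hX').1 (hmaps (hmem hy)) _ hyX)
      (right_mem_branch (hX' hyX))
  · exact hroot ▸ ⟨φ, hφ.mono (branch_subset y hy),
      hφ.mapsTo_branch hx (hmem hy) (branch_subset y hy), rfl⟩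

theorem dist_eq_add_of_mem_branch_of_ne (hT : T.IsTree) {x y z u v : V} (hy : T.Adj x y)
    (hz : T.Adj x z) (hne : y ≠ z) (hu : u ∈ branch T x y) (hv : v ∈ branch T x z) :
    T.dist u v = T.dist u x + T.dist x v :=
  dist_eq_add_of_mem_branches hT hy hu (branch_subset_branch hT hz hy hne.symm hv)

theorem IsoOn.of_branches (hT : T.IsTree) {N : Set V} {x : V} {φ : V → V}
    (hN : N ⊆ T.neighborSet x) (hφN : Set.MapsTo φ N (T.neighborSet (φ x)))
    (hinj : Set.InjOn φ N) (hiso : ∀ y ∈ N, IsoOn T (branch T x y) φ)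
    (hmaps : ∀ y ∈ N, Set.MapsTo φ (branch T x y) (branch T (φ x) (φ y))) :
    IsoOn T {w | w = x ∨ ∃ y ∈ N, w ∈ branch T x y} φ := by
  have dist_root : ∀ y ∈ N, ∀ w ∈ branch T x y, T.dist (φ w) (φ x) = T.dist w x := by
    intro y hy w hw
    rw [mem_branch.1 (hmaps y hy hw), mem_branch.1 hw, hiso y hy w hw y (right_mem_branch (hN hy))]
  rintro u (rfl | ⟨y, hy, hu⟩) v (rfl | ⟨z, hz, hv⟩)
  · rw [dist_self, dist_self]
  · rw [dist_comm, dist_root z hz v hv, dist_comm]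
  · exact dist_root y hy u hu
  · obtain rfl | hne := eq_or_ne y z
    · exact hiso y hy u hu v hv
    · rw [dist_eq_add_of_mem_branch_of_ne hT (hN hy) (hN hz) hne hu hv,
        dist_eq_add_of_mem_branch_of_ne hT (hφN hy) (hφN hz) (hinj.ne hy hz hne) (hmaps y hy hu)
          (hmaps z hz hv),
        dist_root y hy u hu, dist_comm (u := φ x), dist_root z hz v hv, dist_comm (u := x)]

theorem rootedComponent_le_of_branchMap (hT : T.IsTree) {X X' : Set V} {x x' : V}
    (hX : X ⊆ T.neighborSet x) (hX' : X' ⊆ T.neighborSet x') {ι : V → V}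
    (hι : Set.MapsTo ι (T.neighborSet x \ X) (T.neighborSet x' \ X'))
    (hinj : Set.InjOn ι (T.neighborSet x \ X))
    (h : ∀ y ∈ T.neighborSet x \ X, rootedBranch T x y ≤ rootedBranch T x' (ι y)) :
    rootedComponent T X x ≤ rootedComponent T X' x' := by
  classical
  choose! ψ hiso hmaps hroot using h
  have exists_branch : ∀ w, (∃ y ∈ T.neighborSet x \ X, w ∈ branch T x y) →
      ∃ y ∈ T.neighborSet x \ X, w ∈ branch T x y := fun _ => id
  choose! b hbN hb using exists_branch
  let φ : V → V := fun w => if w = x then x' else ψ (b w) w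
  have hφx : φ x = x' := if_pos rfl
  have φ_eq : ∀ y ∈ T.neighborSet x \ X, Set.EqOn φ (ψ y) (branch T x y) := by
    intro y hy w hw
    have hwx : w ≠ x := fun hwx => notMem_branch_symm (hwx ▸ hw) (left_mem_branch hy.1)
    have hby : b w = y :=
      eq_of_mem_branch hT (hbN w ⟨y, hy, hw⟩).1 hy.1 (hb w ⟨y, hy, hw⟩) hw
    rw [show φ w = ψ (b w) w from if_neg hwx, hby]
  have φ_eq_ι : Set.EqOn φ ι (T.neighborSet x \ X) := fun y hy =>
    (φ_eq y hy (right_mem_branch hy.1)).trans (hroot y hy)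
  have φ_mapsTo : ∀ y ∈ T.neighborSet x \ X,
      Set.MapsTo φ (branch T x y) (branch T x' (ι y)) := fun y hy =>
    (hmaps y hy : Set.MapsTo _ _ _).congr (φ_eq y hy).symm
  have φ_isoOn : IsoOn T {w | w = x ∨ ∃ y ∈ T.neighborSet x \ X, w ∈ branch T x y} φ := by
    refine .of_branches hT Set.sdiff_subset (hφx ▸ fun y hy => φ_eq_ι hy ▸ (hι hy).1)
      (hinj.congr φ_eq_ι.symm) (fun y hy u hu v hv => ?_) fun y hy => ?_
    · rw [φ_eq y hy hu, φ_eq y hy hv]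
      exact hiso y hy u hu v hv
    · rw [hφx, φ_eq_ι hy]
      exact φ_mapsTo y hy
  have mem_iff := @mem_componentAvoiding_iff_exists_mem_branch _ T
  refine ⟨φ, φ_isoOn.mono fun w hw => (mem_iff hT hX).1 hw, fun w hw => (mem_iff hT hX').2 ?_, hφx⟩
  obtain rfl | ⟨y, hy, hw⟩ := (mem_iff hT hX).1 hw
  · exact Or.inl hφx
  · exact Or.inr ⟨ι y, hι hy, φ_mapsTo y hy hw⟩

/-! ### The pieces of a tree along a ray -/

namespace Ray

/-- The tree `T_{x_n}` attached to the ray at `x_n`, rooted at `x_n`. -/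
def rootedPiece (C : Ray T) (n : ℕ) : RootedSet T := rootedComponent T (C.neighbours n) (C.vertex n)

/-- The part of the origin in the tree cut at the edge `x_n x_{n+1}`, rooted at `x_n`. -/
def rootedBack (C : Ray T) (n : ℕ) : RootedSet T := rootedBranch T (C.vertex (n + 1)) (C.vertex n)

/-- The neighbours of `x_n` that do not lie on the ray. -/
def offNeighbours (C : Ray T) (n : ℕ) : Set V := T.neighborSet (C.vertex n) \ C.neighbours n

theorem neighbours_subset (C : Ray T) (n : ℕ) : C.neighbours n ⊆ T.neighborSet (C.vertex n) := by
  rintro _ (rfl | ⟨j, rfl, rfl⟩)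
  · exact C.adj n
  · exact (C.adj j).symm

theorem vertex_notMem_neighbours (C : Ray T) (n : ℕ) : C.vertex n ∉ C.neighbours n := fun h =>
  T.irrefl (C.neighbours_subset n h)

theorem neighbours_zero (C : Ray T) : C.neighbours 0 = {C.vertex 1} := by
  ext v
  simp only [neighbours, Nat.add_eq_zero_iff, one_ne_zero, and_false, false_and, exists_false,
    or_false, zero_add, Set.mem_ofPred_eq, Set.mem_singleton_iff]

theorem neighbours_succ (C : Ray T) (n : ℕ) :
    C.neighbours (n + 1) = {C.vertex (n + 2), C.vertex n} := by
  ext v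
  simp only [neighbours, Nat.add_right_cancel_iff, exists_eq_left, Set.mem_ofPred_eq,
    Set.mem_insert_iff, Set.mem_singleton_iff, add_assoc, Nat.reduceAdd]

theorem mem_piece (hT : T.IsTree) (C : Ray T) {n : ℕ} {w : V} :
    w ∈ C.piece n ↔ w ∈ C.back n ∧ ∀ j, j + 1 = n → w ∈ C.front j := by
  rw [piece, mem_componentAvoiding_iff hT (C.neighbours_subset n)]
  constructor
  · refine fun h => ⟨h _ (Or.inl rfl), ?_⟩
    rintro j rfl
    exact h _ (Or.inr ⟨j, rfl, rfl⟩)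
  · rintro ⟨hback, hfront⟩ _ (rfl | ⟨j, rfl, rfl⟩)
    · exact hback
    · exact hfront j rfl

theorem PieceEmbeds.rootedPiece_le (hT : T.IsTree) {C : Ray T} {i j : ℕ}
    (h : C.PieceEmbeds i j) : C.rootedPiece i ≤ C.rootedPiece j :=
  RootedSet.le_of_rootedEmbeds hT
    (induce_componentAvoiding_connected (C.vertex_notMem_neighbours i)) h

theorem rootedPiece_le_rootedBack (hT : T.IsTree) (C : Ray T) (n : ℕ) :
    C.rootedPiece n ≤ C.rootedBack n :=
  ⟨id, fun _ _ _ _ => rfl, fun _ hw => ((C.mem_piece hT).1 hw).1, rfl⟩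

theorem exists_mem_piece (hT : T.IsTree) (C : Ray T) (w : V) : ∃ n, w ∈ C.piece n := by
  classical
  have hex := C.exists_mem_back hT w
  refine ⟨Nat.find hex, (C.mem_piece hT).2 ⟨Nat.find_spec hex, fun j hj => ?_⟩⟩
  exact (C.mem_back_or_mem_front hT j w).resolve_left (Nat.find_min hex (by omega))

theorem dist_of_mem_piece_of_mem_piece (hT : T.IsTree) (C : Ray T) {u v : V} {n m : ℕ}
    (hu : u ∈ C.piece n) (hv : v ∈ C.piece m) (h : n < m) :
    T.dist u v = T.dist u (C.vertex n) + (m - n) + T.dist v (C.vertex m) := by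
  obtain ⟨j, rfl⟩ := Nat.exists_eq_add_of_le' (Nat.one_le_of_lt h)
  rw [C.dist_of_mem_back_of_mem_front hT ((C.mem_piece hT).1 hu).1
    (((C.mem_piece hT).1 hv).2 j rfl) (Nat.le_of_lt_succ h), dist_comm (u := C.vertex _)]

theorem eq_of_mem_piece_of_mem_piece (hT : T.IsTree) (C : Ray T) {u : V} {n m : ℕ}
    (hn : u ∈ C.piece n) (hm : u ∈ C.piece m) : n = m := by
  have not_lt : ∀ {i j}, u ∈ C.piece i → u ∈ C.piece j → ¬ i < j := by
    intro i j hi hj hij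
    have hdist := C.dist_of_mem_piece_of_mem_piece hT hi hj hij
    rw [dist_self] at hdist
    omega
  exact Nat.le_antisymm (Nat.not_lt.1 (not_lt hm hn)) (Nat.not_lt.1 (not_lt hn hm))

theorem branch_subset_piece (hT : T.IsTree) (C : Ray T) {n : ℕ} {y : V}
    (hy : y ∈ C.offNeighbours n) : branch T (C.vertex n) y ⊆ C.piece n := fun _ hw =>
  (mem_componentAvoiding_iff_exists_mem_branch hT (C.neighbours_subset n)).2 (Or.inr ⟨y, hy, hw⟩)

theorem exists_embedding_of_rootedPiece_le (hT : T.IsTree) {C D : Ray T}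
    (h : ∀ n, C.rootedPiece n ≤ D.rootedPiece n) :
    ∃ f : T ↪g T, ∀ n, f (C.vertex n) = D.vertex n := by
  choose ψ hiso hmaps hroot using h
  choose ν hν using C.exists_mem_piece hT
  let φ : V → V := fun w => ψ (ν w) w
  have hφ : ∀ w, φ w ∈ D.piece (ν w) := fun w => hmaps _ (hν w)
  have dist_root : ∀ w, T.dist (φ w) (D.vertex (ν w)) = T.dist w (C.vertex (ν w)) := by
    intro w
    refine (congrArg _ (hroot (ν w)).symm).trans ?_
    exact hiso _ w (hν w) _ (C.vertex_mem_piece _)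
  have dist_of_lt : ∀ u v, ν u < ν v → T.dist (φ u) (φ v) = T.dist u v := by
    intro u v huv
    rw [C.dist_of_mem_piece_of_mem_piece hT (hν u) (hν v) huv,
      D.dist_of_mem_piece_of_mem_piece hT (hφ u) (hφ v) huv, dist_root, dist_root]
  have hφiso : IsoOn T Set.univ φ := by
    intro u _ v _
    obtain huv | huv | huv := lt_trichotomy (ν u) (ν v)
    · exact dist_of_lt u v huv
    · have hu := hν u
      simp only [φ, huv] at hu ⊢
      exact hiso _ u hu v (hν v)
    · rw [dist_comm, dist_of_lt v u huv, dist_comm]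
  refine ⟨hφiso.toEmbedding hT, fun n => ?_⟩
  change ψ (ν (C.vertex n)) (C.vertex n) = _
  rw [C.eq_of_mem_piece_of_mem_piece hT (hν _) (C.vertex_mem_piece n)]
  exact hroot n

theorem rootedBack_eq_rootedComponent (hT : T.IsTree) (C : Ray T) (n : ℕ) :
    C.rootedBack n = rootedComponent T {C.vertex (n + 1)} (C.vertex n) :=
  congrArg (RootedSet.mk · _) (branch_eq_componentAvoiding hT (C.adj n))

theorem rootedPiece_tail_zero (hT : T.IsTree) (C : Ray T) (i : ℕ) :
    (C.tail i).rootedPiece 0 = C.rootedBack i := by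
  rw [rootedPiece, neighbours_zero, rootedBack_eq_rootedComponent hT]
  rfl

theorem rootedPiece_tail_succ (C : Ray T) (i n : ℕ) :
    (C.tail i).rootedPiece (n + 1) = C.rootedPiece (i + n + 1) := by
  rw [rootedPiece, rootedPiece, neighbours_succ, neighbours_succ]
  rfl

/-- `f` shifts the vertices of `C` far from the origin by `l`. -/
def ShiftedBy (C : Ray T) (f : T ↪g T) (l : ℕ) : Prop :=
  ∀ᶠ n in Filter.atTop, f (C.vertex n) = C.vertex (n + l)

theorem ShiftedBy.eq {C : Ray T} {f : T ↪g T} {l l' : ℕ} (h : C.ShiftedBy f l)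
    (h' : C.ShiftedBy f l') : l = l' := by
  obtain ⟨n, hn, hn'⟩ := (Filter.Eventually.and h h').exists
  exact Nat.add_left_cancel (C.injective (hn.symm.trans hn'))

theorem exists_shiftedBy (hT : T.IsTree) (C : Ray T) {f : T ↪g T}
    (h : C.toEnd.PreservedForwardBy f) : ∃ l, C.ShiftedBy f l := by
  obtain ⟨D, hD, hfD⟩ := h
  have hsub : (D.map f).verts ⊆ D.verts := by
    rintro _ ⟨n, rfl⟩
    exact hfD ⟨_, ⟨n, rfl⟩, rfl⟩
  obtain ⟨l, hl⟩ := exists_shift_of_verts_subset hT hsub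
  obtain ⟨a, b, hab⟩ := (toEnd_eq_iff hT).1 hD
  refine ⟨l, Filter.eventually_atTop.2 ⟨b, fun n hn => ?_⟩⟩
  obtain ⟨k, rfl⟩ := Nat.exists_eq_add_of_le hn
  rw [← hab, add_assoc, ← hab, show a + (k + l) = l + (a + k) by ring]
  exact hl (a + k)

/-- Otherwise the embeddings of the pieces would glue to an embedding that shifts the ray
backward. -/
theorem not_rootedBack_le (hT : T.IsTree) {C : Ray T} (hC : ∀ f : T ↪g T, ∃ l, C.ShiftedBy f l)
    {i s : ℕ} (hs : 0 < s) (h : ∀ n, i < n → C.rootedPiece (n + s) ≤ C.rootedPiece n) :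
    ¬ C.rootedBack (i + s) ≤ C.rootedBack i := by
  intro hback
  have hpiece : ∀ n, (C.tail (i + s)).rootedPiece n ≤ (C.tail i).rootedPiece n := by
    rintro (_ | n)
    · rwa [rootedPiece_tail_zero hT, rootedPiece_tail_zero hT]
    · rw [rootedPiece_tail_succ, rootedPiece_tail_succ,
        show i + s + n + 1 = i + n + 1 + s by ring]
      exact h _ (by omega)
  obtain ⟨f, hf⟩ := exists_embedding_of_rootedPiece_le hT hpiece
  obtain ⟨l, hl⟩ := hC f
  obtain ⟨n, hn, hfn⟩ := ((Filter.eventually_ge_atTop (i + s)).and hl).exists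
  obtain ⟨m, rfl⟩ := Nat.exists_eq_add_of_le hn
  have := C.injective (hfn.symm.trans (hf m))
  omega

end Ray

/-! ### Chains of branches that absorb the part of the origin -/

theorem exists_injective_shift {α : Type*} {F : ℕ → α} (hF : Function.Injective F) :
    ∃ ι : α → α, Function.Injective ι ∧ (∀ n, ι (F n) = F (n + 1)) ∧
      ∀ y, y ∉ Set.range F → ι y = y := by
  let ι : α → α := Function.extend F (F ∘ Nat.succ) id
  have ι_F : ∀ n, ι (F n) = F (n + 1) := fun n => hF.extend_apply _ _ n
  have ι_of_notMem : ∀ y, y ∉ Set.range F → ι y = y := fun y hy => Function.extend_apply' _ _ y hy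
  refine ⟨ι, fun y y' heq => ?_, ι_F, ι_of_notMem⟩
  by_cases hy : y ∈ Set.range F <;> by_cases hy' : y' ∈ Set.range F
  · obtain ⟨n, rfl⟩ := hy
    obtain ⟨n', rfl⟩ := hy'
    rw [ι_F, ι_F] at heq
    rw [Nat.succ.inj (hF heq)]
  · obtain ⟨n, rfl⟩ := hy
    rw [ι_F, ι_of_notMem y' hy'] at heq
    exact absurd ⟨n + 1, heq⟩ hy'
  · obtain ⟨n, rfl⟩ := hy'
    rw [ι_F, ι_of_notMem y hy] at heq
    exact absurd ⟨n + 1, heq.symm⟩ hy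
  · rwa [ι_of_notMem y hy, ι_of_notMem y' hy'] at heq

namespace Ray

/-- There is, at `x_n`, an infinite ascending chain of branches off the ray, all of them above the
rooted set `A`. -/
def HasChainAbove (C : Ray T) (n : ℕ) (A : RootedSet T) : Prop :=
  ∃ z : ℕ → V, Function.Injective z ∧ (∀ j, z j ∈ C.offNeighbours n) ∧
    A ≤ rootedBranch T (C.vertex n) (z 0) ∧
    Monotone fun j => rootedBranch T (C.vertex n) (z j)

theorem HasChainAbove.mono {C : Ray T} {n : ℕ} {A B : RootedSet T} (h : C.HasChainAbove n B)
    (hAB : A ≤ B) : C.HasChainAbove n A := by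
  obtain ⟨z, hinj, hoff, h0, hmono⟩ := h
  exact ⟨z, hinj, hoff, hAB.trans h0, hmono⟩

/-- Hilbert's hotel: the part of the origin moves to the first branch of the chain, and each branch
of the chain to the next one. -/
theorem HasChainAbove.rootedBack_le_rootedPiece (hT : T.IsTree) {C : Ray T} {i : ℕ}
    (h : C.HasChainAbove (i + 1) (C.rootedBack i)) :
    C.rootedBack (i + 1) ≤ C.rootedPiece (i + 1) := by
  obtain ⟨z, hinj, hoff, h0, hmono⟩ := h
  have hne : ∀ j, C.vertex i ≠ z j := fun j hj => (hoff j).2 (Or.inr ⟨i, rfl, hj.symm⟩)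
  let F : ℕ → V := fun n => n.casesOn (C.vertex i) z
  have hF : Function.Injective F := by
    rintro (_ | a) (_ | b) hab
    · rfl
    · exact absurd hab (hne b)
    · exact absurd hab.symm (hne a)
    · exact congrArg _ (hinj hab)
  obtain ⟨ι, hι, ι_F, ι_of_notMem⟩ := exists_injective_shift hF
  have hN : ∀ y ∈ T.neighborSet (C.vertex (i + 1)) \ {C.vertex (i + 2)},
      (∃ n, F n = y) ∨ y ∈ C.offNeighbours (i + 1) ∧ y ∉ Set.range F := by
    rintro y ⟨hy, hne'⟩
    refine or_iff_not_imp_left.2 fun hyF => ⟨⟨hy, ?_⟩, hyF⟩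
    rw [neighbours_succ]
    exact fun h => h.elim hne' fun h => hyF ⟨0, h.symm⟩
  rw [rootedBack_eq_rootedComponent hT]
  refine rootedComponent_le_of_branchMap hT (ι := ι) (Set.singleton_subset_iff.2 (C.adj _))
    (C.neighbours_subset _) (fun y hy => ?_) hι.injOn fun y hy => ?_
  · obtain ⟨n, rfl⟩ | ⟨hy, hyF⟩ := hN y hy
    · exact ι_F n ▸ hoff n
    · rwa [ι_of_notMem y hyF]
  · obtain ⟨_ | n, rfl⟩ | ⟨-, hyF⟩ := hN y hy
    · exact ι_F 0 ▸ h0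
    · exact ι_F (n + 1) ▸ hmono n.le_succ
    · rw [ι_of_notMem y hyF]

end Ray

/-! ### Eventual periodicity of the pieces along a regular ray -/

open Filter in
theorem eventually_frequently_eq {α : Type*} {c : ℕ → α} (hc : (Set.range c).Finite) :
    ∀ᶠ n in atTop, ∃ᶠ m in atTop, c m = c n := by
  have h : ∀ᶠ n in atTop, ∀ a ∈ Set.range c, (∃ᶠ m in atTop, c m = a) ∨ c n ≠ a := by
    refine (eventually_all_finite hc).2 fun a _ => ?_
    by_cases ha : ∃ᶠ m in atTop, c m = a
    · exact Eventually.of_forall fun _ => Or.inl ha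
    · exact (not_frequently.1 ha).mono fun _ => Or.inr
  exact h.mono fun n hn => (hn (c n) ⟨n, rfl⟩).resolve_right fun h => h rfl

open Filter in
theorem exists_frequently_and_eq {α : Type*} {c : ℕ → α} (hc : (Set.range c).Finite)
    {P : ℕ → Prop} (hP : ∃ᶠ n in atTop, P n) : ∃ a, ∃ᶠ n in atTop, P n ∧ c n = a := by
  by_contra! h
  have h' : ∀ᶠ n in atTop, ∀ a ∈ Set.range c, ¬ (P n ∧ c n = a) :=
    (eventually_all_finite hc).2 fun a _ => (h a).mono fun _ hne hP => hne hP.1 hP.2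
  obtain ⟨n, hn, hn'⟩ := (hP.and_eventually h').exists
  exact hn' (c n) ⟨n, rfl⟩ ⟨hn, rfl⟩

theorem le_add_mul {α : Type*} [Preorder α] {q : ℕ → α} {N k : ℕ}
    (h : ∀ n, N ≤ n → q n ≤ q (n + k)) {n : ℕ} (hn : N ≤ n) (t : ℕ) : q n ≤ q (n + t * k) := by
  induction t with
  | zero => rw [zero_mul, add_zero]
  | succ t ih =>
    rw [Nat.succ_mul, ← add_assoc]
    exact ih.trans (h _ (by omega))

open Filter in
theorem eventually_add_eq {α : Type*} [PartialOrder α] {q : ℕ → α} (hq : (Set.range q).Finite)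
    {k : ℕ} (h : ∀ᶠ n in atTop, q n ≤ q (n + k)) : ∀ᶠ n in atTop, q (n + k) = q n := by
  obtain ⟨N, hN⟩ := eventually_atTop.1 h
  obtain rfl | hk := Nat.eq_zero_or_pos k
  · exact Eventually.of_forall fun _ => rfl
  have hc : (Set.range fun n => (n % k, q n)).Finite := by
    refine ((Set.finite_Iio k).prod hq).subset ?_
    rintro _ ⟨n, rfl⟩
    exact ⟨Nat.mod_lt n hk, n, rfl⟩
  filter_upwards [eventually_frequently_eq hc, eventually_ge_atTop N] with n hrec hn
  obtain ⟨m, hm, hmn⟩ := (hrec.and_eventually (eventually_ge_atTop (n + k))).exists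
  obtain ⟨hmod, hqm⟩ := Prod.mk.inj hm
  refine (hN n hn).antisymm' ?_
  obtain ⟨t, ht⟩ : k ∣ m - (n + k) :=
    (Nat.modEq_iff_dvd' hmn).1 ((Nat.add_mod_right n k).trans hmod.symm)
  have hle := le_add_mul hN (show N ≤ n + k by omega) t
  rwa [mul_comm, ← ht, Nat.add_sub_cancel' hmn, hqm] at hle

theorem add_mul_eq {α : Type*} {q : ℕ → α} {N k : ℕ} (h : ∀ n, N ≤ n → q (n + k) = q n) {n : ℕ}
    (hn : N ≤ n) (t : ℕ) : q (n + t * k) = q n := by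
  induction t with
  | zero => rw [zero_mul, add_zero]
  | succ t ih => rw [Nat.succ_mul, ← add_assoc, h _ (by omega), ih]

theorem add_eq_of_periodic {α : Type*} [PartialOrder α] {q : ℕ → α} {N k l : ℕ} (hk : 0 < k)
    (h : ∀ n, N ≤ n → q (n + k) = q n) (hl : ∀ᶠ n in Filter.atTop, q n ≤ q (n + l)) {n : ℕ}
    (hn : N ≤ n) : q (n + l) = q n := by
  have le_add : ∀ n, N ≤ n → q n ≤ q (n + l) := by
    intro n hn
    obtain ⟨K, hK⟩ := Filter.eventually_atTop.1 hl
    have hle := hK (n + K * k) (le_add_left (Nat.le_mul_of_pos_right K hk))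
    rwa [add_right_comm, add_mul_eq h hn, add_mul_eq h (by omega)] at hle
  refine (le_add n hn).antisymm' ?_
  obtain ⟨k, rfl⟩ := Nat.exists_eq_add_of_le' hk
  calc q (n + l) ≤ q (n + l + k * l) := le_add_mul le_add (by omega) k
    _ = q (n + l * (k + 1)) := congrArg q (by ring)
    _ = q n := add_mul_eq h hn l

namespace Ray

/-- The equimorphy type of the rooted tree `T_{x_n}`. -/
def pieceType (C : Ray T) (n : ℕ) : Antisymmetrization (RootedSet T) (· ≤ ·) :=
  toAntisymmetrization (· ≤ ·) (C.rootedPiece n)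

theorem pieceType_le_iff {C : Ray T} {m n : ℕ} :
    C.pieceType m ≤ C.pieceType n ↔ C.rootedPiece m ≤ C.rootedPiece n :=
  toAntisymmetrization_le_toAntisymmetrization_iff

theorem IsRegular.finite_range_pieceType (hT : T.IsTree) {C : Ray T} (h : C.IsRegular) :
    (Set.range C.pieceType).Finite := by
  obtain ⟨F, hF⟩ := h
  refine (F.finite_toSet.image C.pieceType).subset ?_
  rintro _ ⟨i, rfl⟩
  obtain ⟨j, hj, hij, hji⟩ := hF i
  exact ⟨j, hj, (pieceType_le_iff.2 (hji.rootedPiece_le hT)).antisymm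
    (pieceType_le_iff.2 (hij.rootedPiece_le hT))⟩

theorem rootedBack_le_add (hT : T.IsTree) {C : Ray T} {f : T ↪g T} {l n : ℕ}
    (h : ∀ m, n ≤ m → f (C.vertex m) = C.vertex (m + l)) :
    C.rootedBack n ≤ C.rootedBack (n + l) := by
  have hle := rootedBranch_le_map hT f (C.vertex (n + 1)) (C.vertex n)
  rwa [h n le_rfl, h (n + 1) n.le_succ, add_right_comm] at hle

theorem ShiftedBy.eventually_rootedBack_le (hT : T.IsTree) {C : Ray T} {f : T ↪g T} {l : ℕ}
    (h : C.ShiftedBy f l) : ∀ᶠ n in Filter.atTop, C.rootedBack n ≤ C.rootedBack (n + l) :=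
  (Filter.eventually_forall_ge_atTop.2 h).mono fun _ => rootedBack_le_add hT

theorem ShiftedBy.eventually_pieceType_le (hT : T.IsTree) {C : Ray T} {f : T ↪g T} {l : ℕ}
    (h : C.ShiftedBy f l) : ∀ᶠ n in Filter.atTop, C.pieceType n ≤ C.pieceType (n + l) := by
  obtain ⟨N, hN⟩ := Filter.eventually_atTop.1 h
  filter_upwards [Filter.eventually_gt_atTop N] with n hn
  obtain ⟨m, rfl⟩ := Nat.exists_eq_add_of_le' (Nat.one_le_of_lt hn)
  have hX : C.neighbours (m + 1 + l) ⊆ f '' C.neighbours (m + 1) := by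
    rw [add_right_comm, neighbours_succ, neighbours_succ]
    rintro _ (rfl | rfl)
    · exact ⟨_, Or.inl rfl, (hN _ (by omega)).trans (congrArg _ (by ring))⟩
    · exact ⟨_, Or.inr rfl, hN _ (by omega)⟩
  have hle := rootedComponent_le_map hT f (C.neighbours_subset (m + 1)) hX
  rw [hN _ (by omega)] at hle
  exact pieceType_le_iff.2 hle

end Ray

/-! ### Embeddings that do not preserve a ray -/

namespace Ray

/-- `M` is the last index at which `f` does not act on `C` as the shift by `l`. -/
def LastFailure (C : Ray T) (f : T ↪g T) (l M : ℕ) : Prop :=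
  (∀ n, M < n → f (C.vertex n) = C.vertex (n + l)) ∧ f (C.vertex M) ≠ C.vertex (M + l)

namespace LastFailure

variable {C : Ray T} {f : T ↪g T} {l M : ℕ}

theorem shiftedBy (h : C.LastFailure f l M) : C.ShiftedBy f l :=
  (Filter.eventually_gt_atTop M).mono h.1

theorem map_mem_offNeighbours (h : C.LastFailure f l M) {y : V} (hy : T.Adj (C.vertex (M + 1)) y)
    (hy' : y ≠ C.vertex (M + 2)) (hne : f y ≠ C.vertex (M + l)) :
    f y ∈ C.offNeighbours (M + 1 + l) := by
  refine ⟨?_, ?_⟩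
  · rw [← h.1 _ M.lt_succ_self]
    exact f.map_adj_iff.2 hy
  · rw [add_right_comm, neighbours_succ, add_right_comm, ← h.1 (M + 2) (by omega)]
    exact fun hmem => hmem.elim (fun h => hy' (f.injective h)) hne

theorem map_vertex_mem_offNeighbours (h : C.LastFailure f l M) :
    f (C.vertex M) ∈ C.offNeighbours (M + 1 + l) :=
  h.map_mem_offNeighbours (C.adj M).symm (fun h => by have := C.injective h; omega) h.2

theorem rootedBranch_le (hT : T.IsTree) (h : C.LastFailure f l M) (y : V) :
    rootedBranch T (C.vertex (M + 1)) y ≤ rootedBranch T (C.vertex (M + 1 + l)) (f y) := by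
  rw [← h.1 _ M.lt_succ_self]
  exact rootedBranch_le_map hT f _ _

end LastFailure

theorem exists_lastFailure {C : Ray T} {f : T ↪g T} {l N : ℕ} (h : C.ShiftedBy f l)
    (hN : ¬ (C.tail N).PreservedBy f) : ∃ M, N ≤ M ∧ C.LastFailure f l M := by
  classical
  have hex : ∃ K, ∀ n, K ≤ n → f (C.vertex n) = C.vertex (n + l) := Filter.eventually_atTop.1 h
  have hlt : N < Nat.find hex := by
    by_contra! hle
    refine hN ?_
    rintro _ ⟨_, ⟨n, rfl⟩, rfl⟩
    refine ⟨n + l, ?_⟩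
    change C.vertex (N + (n + l)) = f (C.vertex (N + n))
    rw [Nat.find_spec hex (N + n) (by omega), add_assoc]
  obtain ⟨M, hM⟩ := Nat.exists_eq_add_of_le' (Nat.one_le_of_lt hlt)
  refine ⟨M, by omega, fun n hn => Nat.find_spec hex n (by omega), fun hf => ?_⟩
  refine Nat.find_min hex (m := M) (by omega) fun n hn => ?_
  obtain rfl | hlt := hn.eq_or_lt
  · exact hf
  · exact Nat.find_spec hex n (by omega)

theorem frequently_lastFailure {C : Ray T} (hC : ∀ f : T ↪g T, ∃ l, C.ShiftedBy f l)
    (h : ¬ ∃ N, ∀ f : T ↪g T, (C.tail N).PreservedBy f) :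
    ∃ᶠ M in Filter.atTop, ∃ f l, C.LastFailure f l M := by
  push Not at h
  refine Filter.frequently_atTop.2 fun N => ?_
  obtain ⟨f, hf⟩ := h N
  obtain ⟨l, hl⟩ := hC f
  obtain ⟨M, hM, hfail⟩ := exists_lastFailure hl hf
  exact ⟨M, hM, f, l, hfail⟩

end Ray

theorem injective_iterate_of_notMem_image {α : Type*} {G : α → α} {S : Set α}
    (hmaps : Set.MapsTo G S S) (hinj : Set.InjOn G S) {z : α} (hz : z ∈ S) (hz' : z ∉ G '' S) :
    Function.Injective fun j => G^[j] z := by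
  have ne_of_lt : ∀ a b, a < b → G^[a] z ≠ G^[b] z := by
    intro a b hab heq
    obtain ⟨d, rfl⟩ := Nat.exists_eq_add_of_lt hab
    rw [add_assoc, Function.iterate_add_apply] at heq
    have hz_eq := hinj.iterate hmaps a hz (hmaps.iterate (d + 1) hz) heq
    rw [Function.iterate_succ_apply'] at hz_eq
    exact hz' ⟨_, hmaps.iterate d hz, hz_eq.symm⟩
  intro a b hab
  by_contra hne
  exact (lt_or_gt_of_ne hne).elim (fun h => ne_of_lt a b h hab) fun h => ne_of_lt b a h hab.symm

namespace Ray

/-- Transporting the branches at `x_{i+1}` to `x_{M+1}`, applying `f` and transporting them back,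
one iterates the image of the part of the origin until it returns to the ray, if ever. -/
theorem LastFailure.hasChainAbove_or_exists_between (hT : T.IsTree) {C : Ray T} {f : T ↪g T}
    {l M i : ℕ} (h : C.LastFailure f l M) (hup : C.rootedPiece (i + 1) ≤ C.rootedPiece (M + 1))
    (hdown : C.rootedPiece (M + 1 + l) ≤ C.rootedPiece (i + 1)) :
    C.HasChainAbove (i + 1) (C.rootedBack M) ∨
      ∃ y ∈ C.offNeighbours (i + 1), C.rootedBack M ≤ rootedBranch T (C.vertex (i + 1)) y ∧
        rootedBranch T (C.vertex (i + 1)) y ≤ C.rootedBack (M + l) := by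
  obtain ⟨φ, hφmaps, hφinj, hφle⟩ := exists_branchMap_of_rootedComponent_le hT
    (C.neighbours_subset _) (C.neighbours_subset _) hup
  obtain ⟨ψ, hψmaps, hψinj, hψle⟩ := exists_branchMap_of_rootedComponent_le hT
    (C.neighbours_subset _) (C.neighbours_subset _) hdown
  have hφle' : ∀ y ∈ C.offNeighbours (i + 1), rootedBranch T (C.vertex (i + 1)) y ≤
      rootedBranch T (C.vertex (M + 1 + l)) (f (φ y)) := fun y hy =>
    (hφle y hy).trans (h.rootedBranch_le hT _)
  let S := {y ∈ C.offNeighbours (i + 1) |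
    C.rootedBack M ≤ rootedBranch T (C.vertex (i + 1)) y}
  by_cases hreturn : ∃ y ∈ S, f (φ y) = C.vertex (M + l)
  · obtain ⟨y, ⟨hy, hMy⟩, hfy⟩ := hreturn
    have hle := hφle' y hy
    rw [hfy, add_right_comm] at hle
    exact Or.inr ⟨y, hy, hMy, hle⟩
  left
  have hoff : ∀ y ∈ S, f (φ y) ∈ C.offNeighbours (M + 1 + l) := fun y hy =>
    h.map_mem_offNeighbours (hφmaps hy.1).1 (fun heq => (hφmaps hy.1).2 (Or.inl heq))
      fun heq => hreturn ⟨y, hy, heq⟩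
  have hz := h.map_vertex_mem_offNeighbours
  let G : V → V := fun y => ψ (f (φ y))
  let z₀ := ψ (f (C.vertex M))
  have G_le : ∀ y ∈ S, rootedBranch T (C.vertex (i + 1)) y ≤
      rootedBranch T (C.vertex (i + 1)) (G y) := fun y hy =>
    (hφle' y hy.1).trans (hψle _ (hoff y hy))
  have hG : Set.MapsTo G S S := fun y hy => ⟨hψmaps (hoff y hy), hy.2.trans (G_le y hy)⟩
  have hGinj : Set.InjOn G S := fun y hy y' hy' heq =>
    hφinj hy.1 hy'.1 (f.injective (hψinj (hoff y hy) (hoff y' hy') heq))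
  have hz₀ : z₀ ∈ S := ⟨hψmaps hz, (h.rootedBranch_le hT _).trans (hψle _ hz)⟩
  have hz₀' : z₀ ∉ G '' S := by
    rintro ⟨y, hy, heq⟩
    exact (hφmaps hy.1).2 (Or.inr ⟨M, rfl, f.injective (hψinj (hoff y hy) hz heq)⟩)
  refine ⟨fun j => G^[j] z₀, injective_iterate_of_notMem_image hG hGinj hz₀ hz₀',
    fun j => (hG.iterate j hz₀).1, hz₀.2, monotone_nat_of_le_succ fun j => ?_⟩
  simp only [Function.iterate_succ_apply']
  exact G_le _ (hG.iterate j hz₀)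

end Ray

/-! ### Regular ends that are shifted by some embedding -/

theorem exists_strictMono_of_between {α β : Type*} [Preorder β] {b : ℕ → β} (hb : StrictMono b)
    {d : α → β} {S : Set α} (h : ∀ a, ∃ y ∈ S, ∃ c, b a ≤ d y ∧ d y ≤ b c) :
    ∃ z : ℕ → α, (∀ j, z j ∈ S) ∧ b 0 ≤ d (z 0) ∧ StrictMono (d ∘ z) := by
  choose y hyS c hby hyc using h
  let a : ℕ → ℕ := fun j => (fun n => c n + 1)^[j] 0
  refine ⟨y ∘ a, fun j => hyS _, hby _, strictMono_nat_of_lt_succ fun j => ?_⟩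
  have ha : a (j + 1) = c (a j) + 1 := Function.iterate_succ_apply' _ j 0
  calc d (y (a j)) ≤ b (c (a j)) := hyc _
    _ < b (a (j + 1)) := hb (ha ▸ Nat.lt_succ_self _)
    _ ≤ d (y (a (j + 1))) := hby _

namespace Ray

/-- From `x_N` on, the types of the pieces along the ray are `k`-periodic, and the parts of the
origin ascend in steps of `k`. -/
structure PeriodicFrom (C : Ray T) (k N : ℕ) : Prop where
  pos : 0 < k
  pieceType_add : ∀ n, N ≤ n → C.pieceType (n + k) = C.pieceType n
  rootedBack_le : ∀ n, N ≤ n → C.rootedBack n ≤ C.rootedBack (n + k)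

theorem exists_periodicFrom (hT : T.IsTree) {C : Ray T} (hreg : C.IsRegular) {f : T ↪g T} {k : ℕ}
    (hk : 0 < k) (hf : C.ShiftedBy f k) : ∃ N, C.PeriodicFrom k N := by
  obtain ⟨N, hN⟩ := Filter.eventually_atTop.1 ((hf.eventually_rootedBack_le hT).and
    (eventually_add_eq (hreg.finite_range_pieceType hT) (hf.eventually_pieceType_le hT)))
  exact ⟨N, hk, fun n hn => (hN n hn).2, fun n hn => (hN n hn).1⟩

namespace PeriodicFrom

variable {C : Ray T} {k N i : ℕ}

theorem pieceType_add_mul (h : C.PeriodicFrom k N) {n : ℕ} (hn : N ≤ n) (t : ℕ) :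
    C.pieceType (n + t * k) = C.pieceType n :=
  add_mul_eq h.pieceType_add hn t

theorem strictMono_rootedBack (hT : T.IsTree) (hC : ∀ f : T ↪g T, ∃ l, C.ShiftedBy f l)
    (h : C.PeriodicFrom k N) (hi : N ≤ i) : StrictMono fun a => C.rootedBack (i + a * k) := by
  refine strictMono_nat_of_lt_succ fun a => ?_
  have hlt : C.rootedBack (i + a * k) < C.rootedBack (i + a * k + k) :=
    lt_of_le_not_ge (h.rootedBack_le _ (by omega)) <|
      not_rootedBack_le hT hC h.pos fun n hn => pieceType_le_iff.1 (h.pieceType_add n (by omega)).le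
  rwa [add_assoc, ← Nat.succ_mul] at hlt

theorem not_hasChainAbove (hT : T.IsTree) (hC : ∀ f : T ↪g T, ∃ l, C.ShiftedBy f l)
    (h : C.PeriodicFrom k N) (hi : N + k ≤ i) : ¬ C.HasChainAbove (i + 1) (C.rootedBack i) := by
  intro hchain
  obtain ⟨j, rfl⟩ := Nat.exists_eq_add_of_le' (show k ≤ i by omega)
  have hj : N ≤ j + 1 := by omega
  refine not_rootedBack_le hT hC (i := j + 1) h.pos
    (fun n hn => pieceType_le_iff.1 (h.pieceType_add n (by omega)).le) ?_
  have hle := hchain.rootedBack_le_rootedPiece hT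
  rw [add_right_comm] at hle
  exact hle.trans ((pieceType_le_iff.1 (h.pieceType_add _ hj).le).trans
    (C.rootedPiece_le_rootedBack hT _))

theorem exists_between (hT : T.IsTree) (hC : ∀ f : T ↪g T, ∃ l, C.ShiftedBy f l)
    (h : C.PeriodicFrom k N) (hi : N + k ≤ i) {f : T ↪g T} {l a : ℕ}
    (hfail : C.LastFailure f l (i + a * k)) :
    ∃ y ∈ C.offNeighbours (i + 1), ∃ c,
      C.rootedBack (i + a * k) ≤ rootedBranch T (C.vertex (i + 1)) y ∧
      rootedBranch T (C.vertex (i + 1)) y ≤ C.rootedBack (i + c * k) := by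
  have htype : C.pieceType (i + a * k + 1) = C.pieceType (i + 1) := by
    rw [add_right_comm, h.pieceType_add_mul (by omega)]
  have htype' : C.pieceType (i + a * k + 1 + l) = C.pieceType (i + 1) := by
    rw [add_eq_of_periodic h.pos h.pieceType_add (hfail.shiftedBy.eventually_pieceType_le hT)
      (by omega), htype]
  obtain hchain | ⟨y, hy, hle, hge⟩ := hfail.hasChainAbove_or_exists_between hT
    (pieceType_le_iff.1 htype.ge) (pieceType_le_iff.1 htype'.le)
  · have hmono := (h.strictMono_rootedBack hT hC (show N ≤ i by omega)).monotone a.zero_le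
    simp only [zero_mul, add_zero] at hmono
    exact absurd (hchain.mono hmono) (h.not_hasChainAbove hT hC hi)
  refine ⟨y, hy, a + l, hle, hge.trans ?_⟩
  obtain rfl | hl := Nat.eq_zero_or_pos l
  · rfl
  obtain ⟨k, rfl⟩ := Nat.exists_eq_add_of_le' h.pos
  have hshift := le_add_mul (q := C.rootedBack) (N := i + a * (k + 1) + 1)
    (fun n hn => rootedBack_le_add hT fun m hm => hfail.1 m (hn.trans hm))
    (n := i + a * (k + 1) + l) (by omega) k
  refine hshift.trans_eq (congrArg _ ?_)
  ring

end PeriodicFrom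

theorem exists_preserved_tail_of_shift (hT : T.IsTree) {C : Ray T} (hreg : C.IsRegular)
    (hC : ∀ f : T ↪g T, ∃ l, C.ShiftedBy f l) {f : T ↪g T} {k : ℕ} (hk : 0 < k)
    (hf : C.ShiftedBy f k) : ∃ N, ∀ f : T ↪g T, (C.tail N).PreservedBy f := by
  by_contra hcon
  obtain ⟨N, hN⟩ := exists_periodicFrom hT hreg hk hf
  have hmod : (Set.range (· % k)).Finite :=
    (Set.finite_Iio k).subset (Set.range_subset_iff.2 fun n => Nat.mod_lt n hk)
  obtain ⟨r, hr⟩ := exists_frequently_and_eq hmod (frequently_lastFailure hC hcon)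
  rw [Filter.frequently_atTop] at hr
  obtain ⟨i, hi, -, hir⟩ := hr (N + k)
  have hmono := hN.strictMono_rootedBack hT hC (show N ≤ i by omega)
  have hbetween : ∀ a, ∃ y ∈ C.offNeighbours (i + 1), ∃ c,
      C.rootedBack (i + a * k) ≤ rootedBranch T (C.vertex (i + 1)) y ∧
      rootedBranch T (C.vertex (i + 1)) y ≤ C.rootedBack (i + c * k) := by
    intro a
    obtain ⟨M, hM, ⟨g, l, hfail⟩, hMr⟩ := hr (i + a * k)
    obtain ⟨a', ha'⟩ := (Nat.modEq_iff_dvd' (show i ≤ M by omega)).1 (hir.trans hMr.symm)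
    obtain rfl : M = i + a' * k := by rw [mul_comm, ← ha']; omega
    have ha : a ≤ a' := Nat.le_of_mul_le_mul_right (Nat.le_of_add_le_add_left hM) hk
    obtain ⟨y, hy, c, hle, hge⟩ := hN.exists_between hT hC hi hfail
    exact ⟨y, hy, c, (hmono.monotone ha).trans hle, hge⟩
  obtain ⟨z, hz, hz₀, hzmono⟩ := exists_strictMono_of_between hmono hbetween
  refine hN.not_hasChainAbove hT hC hi ⟨z, hzmono.injective.of_comp, hz, ?_, hzmono.monotone⟩
  simpa only [zero_mul, add_zero] using hz₀

end Ray

/-! ### Regular ends of scattered trees that are fixed by all embeddings -/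

/-- `p` maps `S` into itself, preserves the distances, and moves `S` away from `r`: the image of
`S` lies beyond the image of `r`. -/
structure IsAscending (T : SimpleGraph V) (S : Set V) (r : V) (p : V → V) : Prop where
  isoOn : IsoOn T S p
  mapsTo : Set.MapsTo p S S
  below : ∀ v ∈ S, Below T r (p r) (p v)

namespace IsAscending

variable {S : Set V} {r : V} {p q : V → V}

theorem id : IsAscending T S r id := ⟨fun _ _ _ _ => rfl, Set.mapsTo_id S, fun v _ => .root r v⟩

theorem dist_root (hp : IsAscending T S r p) (hr : r ∈ S) {v : V} (hv : v ∈ S) :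
    T.dist r (p v) = T.dist r (p r) + T.dist r v := by
  rw [← hp.below v hv, hp.isoOn r hr v hv]

theorem comp (hr : r ∈ S) (hq : IsAscending T S r q) (hp : IsAscending T S r p) :
    IsAscending T S r (q ∘ p) where
  isoOn := hq.isoOn.comp hp.isoOn hp.mapsTo
  mapsTo := hq.mapsTo.comp hp.mapsTo
  below v hv := by
    have hbelow : T.dist r (p r) + T.dist (p r) (p v) = T.dist r (p v) := hp.below v hv
    rw [Below, Function.comp_apply, Function.comp_apply, hq.dist_root hr (hp.mapsTo hr),
      hq.dist_root hr (hp.mapsTo hv), hq.isoOn _ (hp.mapsTo hr) _ (hp.mapsTo hv), add_assoc, hbelow]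

theorem below_map_iff (hp : IsAscending T S r p) (hr : r ∈ S) {u v : V} (hu : u ∈ S) (hv : v ∈ S) :
    Below T r (p u) (p v) ↔ Below T r u v := by
  rw [Below, Below, hp.dist_root hr hu, hp.dist_root hr hv, hp.isoOn u hu v hv]
  omega

theorem not_isScattered (hT : T.IsTree) (hr : r ∈ S) (hp : IsAscending T S r p)
    (hq : IsAscending T S r q) (hpq : ¬ Below T r (p r) (q r)) (hqp : ¬ Below T r (q r) (p r)) :
    ¬ IsScattered T := by
  refine not_isScattered_of_branching hT r (G := {s | ∃ w, IsAscending T S r w ∧ w r = s})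
    ⟨r, _, .id, rfl⟩ ?_
  rintro _ ⟨w, hw, rfl⟩
  refine ⟨w (p r), ⟨_, hw.comp hr hp, rfl⟩, w (q r), ⟨_, hw.comp hr hq, rfl⟩,
    hw.below _ (hp.mapsTo hr), hw.below _ (hq.mapsTo hr), ?_, ?_⟩
  · rwa [hw.below_map_iff hr (hp.mapsTo hr) (hq.mapsTo hr)]
  · rwa [hw.below_map_iff hr (hq.mapsTo hr) (hp.mapsTo hr)]

end IsAscending

namespace Ray

theorem dist_vertex_of_mem_branch (hT : T.IsTree) (C : Ray T) {i M : ℕ} {y w : V}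
    (hy : y ∈ C.offNeighbours i) (hiM : i ≤ M) (hw : w ∈ branch T (C.vertex i) y) :
    T.dist (C.vertex M) w = M - i + 1 + T.dist y w := by
  have hdist := C.dist_of_mem_back hT ((C.mem_piece hT).1 (C.branch_subset_piece hT hy hw)).1 hiM
  rw [mem_branch.1 hw, dist_comm, dist_comm (v := y)] at hdist
  omega

theorem exists_isAscending (hT : T.IsTree) (C : Ray T) {i M : ℕ} {y : V}
    (hy : y ∈ C.offNeighbours i) (hiM : i ≤ M)
    (h : C.rootedBack M ≤ rootedBranch T (C.vertex i) y) :
    ∃ p, IsAscending T (C.back M) (C.vertex M) p ∧ p (C.vertex M) = y := by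
  obtain ⟨p, hiso, hmaps, hroot⟩ := h
  change p (C.vertex M) = y at hroot
  refine ⟨p, ⟨hiso, fun v hv => ?_, fun v hv => ?_⟩, hroot⟩
  · exact C.back_mono hT hiM ((C.mem_piece hT).1 (C.branch_subset_piece hT hy (hmaps hv))).1
  · rw [hroot, Below, C.dist_vertex_of_mem_branch hT hy hiM (hmaps hv),
      C.dist_vertex_of_mem_branch hT hy hiM (right_mem_branch hy.1), dist_self, add_zero]

theorem not_below_of_mem_offNeighbours (hT : T.IsTree) (C : Ray T) {i j M : ℕ} {y y' : V}
    (hij : i < j) (hjM : j ≤ M) (hy : y ∈ C.offNeighbours i) (hy' : y' ∈ C.offNeighbours j) :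
    ¬ Below T (C.vertex M) y y' ∧ ¬ Below T (C.vertex M) y' y := by
  have hyy' := C.dist_of_mem_piece_of_mem_piece hT
    (C.branch_subset_piece hT hy (right_mem_branch hy.1))
    (C.branch_subset_piece hT hy' (right_mem_branch hy'.1)) hij
  have hMy := C.dist_vertex_of_mem_branch hT hy (by omega : i ≤ M) (right_mem_branch hy.1)
  have hMy' := C.dist_vertex_of_mem_branch hT hy' hjM (right_mem_branch hy'.1)
  rw [dist_comm (v := C.vertex i), dist_comm (v := C.vertex j), dist_eq_one hy.1,
    dist_eq_one hy'.1] at hyy'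
  rw [dist_self] at hMy hMy'
  rw [Below, Below, dist_comm (u := y')]
  omega

theorem LastFailure.exists_rootedBack_le (hT : T.IsTree) {C : Ray T} {f : T ↪g T} {M i : ℕ}
    (h : C.LastFailure f 0 M) (hle : C.rootedPiece (M + 1) ≤ C.rootedPiece i) :
    ∃ y ∈ C.offNeighbours i, C.rootedBack M ≤ rootedBranch T (C.vertex i) y := by
  obtain ⟨ψ, hmaps, -, hψ⟩ := exists_branchMap_of_rootedComponent_le hT
    (C.neighbours_subset _) (C.neighbours_subset _) hle
  exact ⟨_, hmaps h.map_vertex_mem_offNeighbours,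
    (h.rootedBranch_le hT _).trans (hψ _ h.map_vertex_mem_offNeighbours)⟩

theorem exists_preserved_tail_of_isScattered (hT : T.IsTree) (hs : IsScattered T) {C : Ray T}
    (hreg : C.IsRegular) (hC : ∀ f : T ↪g T, C.ShiftedBy f 0) :
    ∃ N, ∀ f : T ↪g T, (C.tail N).PreservedBy f := by
  by_contra hcon
  have hfinite : (Set.range fun M => C.pieceType (M + 1)).Finite :=
    (hreg.finite_range_pieceType hT).subset (Set.range_comp_subset_range Nat.succ C.pieceType)
  obtain ⟨c, hc⟩ := exists_frequently_and_eq hfinite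
    (frequently_lastFailure (fun f => ⟨0, hC f⟩) hcon)
  rw [Filter.frequently_atTop] at hc
  obtain ⟨i, -, -, hi⟩ := hc 0
  obtain ⟨j, hij, -, hj⟩ := hc (i + 1)
  obtain ⟨M, hjM, ⟨f, l, hfail⟩, hM⟩ := hc (j + 1)
  obtain rfl := hfail.shiftedBy.eq (hC f)
  obtain ⟨y, hy, hle⟩ :=
    hfail.exists_rootedBack_le hT (pieceType_le_iff.1 (hM.trans hi.symm).le)
  obtain ⟨y', hy', hle'⟩ :=
    hfail.exists_rootedBack_le hT (pieceType_le_iff.1 (hM.trans hj.symm).le)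
  obtain ⟨p, hp, rfl⟩ := C.exists_isAscending hT hy (by omega) hle
  obtain ⟨q, hq, rfl⟩ := C.exists_isAscending hT hy' (by omega) hle'
  obtain ⟨hpq, hqp⟩ := C.not_below_of_mem_offNeighbours hT (by omega) hjM hy hy'
  exact hp.not_isScattered hT (C.vertex_mem_back hT le_rfl) hq hpq hqp hs

theorem ShiftedBy.preservedBackwardBy {C : Ray T} {f : T ↪g T} (h : C.ShiftedBy f 0) :
    C.toEnd.PreservedBackwardBy f := by
  obtain ⟨N, hN⟩ := Filter.eventually_atTop.1 h
  refine ⟨C.tail N, C.toEnd_tail N, ?_⟩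
  rintro _ ⟨n, rfl⟩
  exact ⟨_, ⟨n, rfl⟩, hN _ (Nat.le_add_right N n)⟩

end Ray

theorem exists_preserved_ray (hT : T.IsTree) {e : TreeEnd T} (hreg : e.IsRegular)
    (hf : ∀ f : T ↪g T, e.PreservedForwardBy f) (h : IsScattered T ∨ ¬ e.IsAlmostRigid) :
    ∃ C : Ray T, C.toEnd = e ∧ ∀ f : T ↪g T, C.PreservedBy f := by
  obtain ⟨C, rfl, hC⟩ := hreg
  have hshift : ∀ f : T ↪g T, ∃ l, C.ShiftedBy f l := fun f => C.exists_shiftedBy hT (hf f)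
  suffices hN : ∃ N, ∀ f : T ↪g T, (C.tail N).PreservedBy f by
    obtain ⟨N, hN⟩ := hN
    exact ⟨C.tail N, C.toEnd_tail N, hN⟩
  by_cases hpos : ∃ f k, 0 < k ∧ C.ShiftedBy f k
  · obtain ⟨f, k, hk, hfk⟩ := hpos
    exact Ray.exists_preserved_tail_of_shift hT hC hshift hk hfk
  have hzero : ∀ f : T ↪g T, C.ShiftedBy f 0 := by
    intro f
    obtain ⟨l, hl⟩ := hshift f
    obtain rfl | hl' := Nat.eq_zero_or_pos l
    · exact hl
    · exact absurd ⟨f, l, hl', hl⟩ hpos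
  obtain hs | hrigid := h
  · exact Ray.exists_preserved_tail_of_isScattered hT hs hC hzero
  · exact absurd (fun f => ⟨(hzero f).preservedBackwardBy, hf f⟩) hrigid

end TreeEmb

theorem theorem1p3 {V : Type u} (T : SimpleGraph V) (hT : T.IsTree) :
    (TreeEmb.IsScattered T →
      ∀ e : TreeEmb.TreeEnd T, e.HasMaximalOrder →
        (∀ e' : TreeEmb.TreeEnd T, e'.HasMaximalOrder → e' = e) →
          ∀ f : T ↪g T, e.PreservedForwardBy f) ∧
    (∀ e : TreeEmb.TreeEnd T, e.IsRegular → (∀ f : T ↪g T, e.PreservedForwardBy f) →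
      (TreeEmb.IsScattered T ∨ ¬ e.IsAlmostRigid) →
        ∃ C : TreeEmb.Ray T, C.toEnd = e ∧ ∀ f : T ↪g T, C.PreservedBy f) :=
  ⟨fun hs _ he hu f => TreeEmb.preservedForwardBy_of_unique_maximal hT hs he hu f,
    fun _ hreg hf h => TreeEmb.exists_preserved_ray hT hreg hf h⟩
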